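/- Let $\psi=\Gamma'/\Gamma$ be the digamma function, $\gamma$ Euler's constant and $\zeta$ the Riemann zeta function. For $x\in\mathbb{C}\setminus(-\infty,0]$ and integers $r\ge 2$ put $$F(x)=\sum_{n=1}^{\infty}\frac{\psi(nx)-\log(nx)}{n},\qquad F_r(x)=\sum_{n=1}^{\infty}\frac{\psi(nx)}{n^r}.$$ For $x>0$ and complex $r,s,t$ with $\Re(r+t)>1$, $\Re(s+t)>1$, $\Re(r+s+t)>2$ put $$\Theta(r,s,t,x)=\sum_{n=1}^{\infty}\sum_{m=1}^{\infty}\frac{1}{n^{r}m^{s}(n+mx)^{t}},$$ and for fixed $r,s,x$ denote by the same symbol its meromorphic continuation in $t$. Then the following statements hold. (1) For every real $x>0$, the two-term functional equation $$F(x)+F\left(\frac1x\right)=2F(1)+\frac12\log^2 x-\frac{\pi^2}{6x}(x-1)^2$$ holds at $x$ if and only if, as $t\to 0$ (with $t$ complex), $$\Theta(1,1,t,x)=\frac{2}{t^2}+\frac{2\gamma-\log x}{t}+\gamma^2-\gamma\log x-\frac{\pi^2}{6}+O(|t|).$$ (2) For every integer $r\ge 2$ and every real $x>0$, the two-term functional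 equation $$F_r(x)+(-x)^{r-1}F_r\left(\frac1x\right)=\zeta(r+1)\left((-x)^r-\frac1x\right)-\sum_{\ell=1}^{r}\zeta(\ell)\,\zeta(r-\ell+1)\,(-x)^{\ell-1},$$ in which the divergent value $\zeta(1)$ is interpreted as $\gamma$, holds at $x$ if and only if, as $t\to 1-r$ (with $t$ complex), $$\Theta(r,r,t,x)=\frac{\zeta(r)\left(1+x^{r-1}\right)}{t-(1-r)}+x^{r-1}\zeta(r)(\gamma-\log x)+\gamma\,\zeta(r)+x^{r-1}\sum_{k=1}^{r-2}\binom{r-1}{k}\frac{\zeta(r-k)\,\zeta(k+1)}{x^{k}}+O(|t-(1-r)|).$$ -/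

import Mathlib

open Filter Topology Asymptotics

noncomputable section

namespace HerglotzZagier

/-- The Herglotz–Zagier function `F(x) = ∑_{n ≥ 1} (ψ(nx) - log(nx)) / n`
on `ℂ \ (-∞, 0]`, with `ψ = Γ'/Γ` the digamma function. -/
def F (x : ℂ) : ℂ :=
  ∑' n : ℕ, (Complex.digamma (((n : ℂ) + 1) * x) - Complex.log (((n : ℂ) + 1) * x)) / ((n : ℂ) + 1)

/-- The higher Herglotz function `F_r(x) = ∑_{n ≥ 1} ψ(nx) / n ^ r` on `ℂ \ (-∞, 0]`. -/
def higherF (r : ℕ) (x : ℂ) : ℂ :=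
  ∑' n : ℕ, Complex.digamma (((n : ℂ) + 1) * x) / ((n : ℂ) + 1) ^ r

/-- The values `ζ(k)` at positive integers, where the divergent value `ζ(1)` is
interpreted as Euler's constant `γ`. -/
def zetaValue (k : ℕ) : ℂ :=
  if k = 1 then (Real.eulerMascheroniConstant : ℂ) else riemannZeta k

/-- The region `𝒟` of absolute convergence of the double series for `Θ`. -/
def regionD : Set (ℂ × ℂ × ℂ) :=
  {p | 1 < (p.1 + p.2.2).re ∧ 1 < (p.2.1 + p.2.2).re ∧ 2 < (p.1 + p.2.1 + p.2.2).re}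

/-- The double series `∑_{n ≥ 1} ∑_{m ≥ 1} 1 / (n ^ r * m ^ s * (n + m x) ^ t)`. -/
def thetaSeries (r s t : ℂ) (x : ℝ) : ℂ :=
  ∑' n : ℕ, ∑' m : ℕ,
    1 / (((n : ℂ) + 1) ^ r * ((m : ℂ) + 1) ^ s * (((n : ℂ) + 1) + ((m : ℂ) + 1) * (x : ℂ)) ^ t)

/-- `G` is the meromorphic continuation, in the variable `t` with `r`, `s`, `x` fixed, of the
double series to the half-plane `Re t > σ`. (Normal form only fixes the values: `G` is analytic
wherever it has no pole, and takes the value `0` at its poles.) -/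
def IsThetaContinuation (r s : ℂ) (x σ : ℝ) (G : ℂ → ℂ) : Prop :=
  MeromorphicNFOn G {t : ℂ | σ < t.re} ∧
    ∀ t : ℂ, (r, s, t) ∈ regionD → G t = thetaSeries r s t x

open Classical in
/-- The generalized Mordell–Tornheim zeta function `Θ(r, s, t, x)`, as a function of `t`: the value
at `t` of the meromorphic continuation of the double series to a half-plane that contains `t`.
By `Theta_eq_of_isThetaContinuation` this does not depend on the half-plane, and by
`Theta_eq_thetaSeries` it is the double series itself on `𝒟`. -/
def Theta (r s t : ℂ) (x : ℝ) : ℂ :=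
  if h : ∃ G : ℂ → ℂ, ∃ σ : ℝ, σ < t.re ∧ IsThetaContinuation r s x σ G then h.choose t
  else thetaSeries r s t x

theorem Theta_eq_thetaSeries {r s t : ℂ} (x : ℝ) (ht : (r, s, t) ∈ regionD) :
    Theta r s t x = thetaSeries r s t x := by
  unfold Theta
  split_ifs with h
  · obtain ⟨σ, _, hG⟩ := h.choose_spec
    exact hG.2 t ht
  · rfl

theorem IsThetaContinuation.unique {r s : ℂ} {x σ τ : ℝ} {G H : ℂ → ℂ}
    (hG : IsThetaContinuation r s x σ G) (hH : IsThetaContinuation r s x τ H)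
    {t : ℂ} (hσ : σ < t.re) (hτ : τ < t.re) : G t = H t := by
  set U : Set ℂ := {z : ℂ | max σ τ < z.re} with hU
  have hUo : IsOpen U := isOpen_lt continuous_const Complex.continuous_re
  have hUc : IsPreconnected U := (convex_halfSpace_re_gt (max σ τ)).isPreconnected
  have hmer : MeromorphicOn (G - H) U := fun z hz =>
    (hG.1 (show σ < z.re from lt_of_le_of_lt (le_max_left σ τ) hz)).meromorphicAt.sub
      (hH.1 (show τ < z.re from lt_of_le_of_lt (le_max_right σ τ) hz)).meromorphicAt
  have htU : t ∈ U := max_lt hσ hτ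
  have htop : meromorphicOrderAt (G - H) t = ⊤ := by
    by_contra hne
    set c : ℝ := max (max σ τ) (max (max (1 - r.re) (1 - s.re)) (2 - r.re - s.re)) + 1 with hc
    have hcU : (c : ℂ) ∈ U := by
      show max σ τ < (c : ℂ).re
      rw [Complex.ofReal_re]
      exact lt_of_le_of_lt (le_max_left _ _) (lt_add_one _)
    have h2 := hmer.meromorphicOrderAt_ne_top_of_isPreconnected hUc htU hcU hne
    apply h2
    rw [meromorphicOrderAt_eq_top_iff]
    refine eventually_nhdsWithin_of_eventually_nhds ?_
    have hV : IsOpen {z : ℂ | max (max (1 - r.re) (1 - s.re)) (2 - r.re - s.re) < z.re} :=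
      isOpen_lt continuous_const Complex.continuous_re
    have hcV : (c : ℂ) ∈
        {z : ℂ | max (max (1 - r.re) (1 - s.re)) (2 - r.re - s.re) < z.re} := by
      show _ < (c : ℂ).re
      rw [Complex.ofReal_re]
      exact lt_of_le_of_lt (le_max_right _ _) (lt_add_one _)
    filter_upwards [hV.mem_nhds hcV] with z hz
    have hz' : max (max (1 - r.re) (1 - s.re)) (2 - r.re - s.re) < z.re := hz
    rw [max_lt_iff, max_lt_iff] at hz'
    have hD : (r, s, z) ∈ regionD := by
      refine ⟨?_, ?_, ?_⟩ <;> simp only [Complex.add_re] <;> linarith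
    simp [hG.2 z hD, hH.2 z hD]
  have hev : G =ᶠ[𝓝[≠] t] H := by
    rw [meromorphicOrderAt_eq_top_iff] at htop
    filter_upwards [htop] with z hz
    exact sub_eq_zero.mp hz
  exact (((hG.1 hσ).eventuallyEq_nhdsNE_iff_eventuallyEq_nhds (hH.1 hτ)).1 hev).eq_of_nhds

theorem Theta_eq_of_isThetaContinuation {r s t : ℂ} {x σ : ℝ} {G : ℂ → ℂ}
    (hG : IsThetaContinuation r s x σ G) (ht : σ < t.re) : Theta r s t x = G t := by
  have h : ∃ G : ℂ → ℂ, ∃ σ : ℝ, σ < t.re ∧ IsThetaContinuation r s x σ G := ⟨G, σ, ht, hG⟩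
  unfold Theta
  rw [dif_pos h]
  obtain ⟨τ, hτ, hH⟩ := h.choose_spec
  exact hH.unique hG hτ ht

/-- The two-term functional equation of `F` at `x`. -/
def TwoTermF (x : ℝ) : Prop :=
  F x + F (1 / (x : ℂ)) =
    2 * F 1 + (1 / 2) * (Real.log x : ℂ) ^ 2 - (Real.pi : ℂ) ^ 2 / (6 * (x : ℂ)) * ((x : ℂ) - 1) ^ 2

/-- The two-term functional equation of `F_r` at `x`. -/
def TwoTermHigherF (r : ℕ) (x : ℝ) : Prop :=
  higherF r x + (-(x : ℂ)) ^ (r - 1) * higherF r (1 / (x : ℂ)) =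
    riemannZeta ((r : ℂ) + 1) * ((-(x : ℂ)) ^ r - 1 / (x : ℂ)) -
      ∑ l ∈ Finset.Icc 1 r, zetaValue l * zetaValue (r - l + 1) * (-(x : ℂ)) ^ (l - 1)

/-- The Kronecker limit formula for `Θ(1, 1, t, x)` as `t → 0` (`t` complex, `t ≠ 0`). -/
def KroneckerLimitOne (x : ℝ) : Prop :=
  (fun t : ℂ => Theta 1 1 t x -
      (2 / t ^ 2 + (2 * (Real.eulerMascheroniConstant : ℂ) - Real.log x) / t
        + (Real.eulerMascheroniConstant : ℂ) ^ 2
        - (Real.eulerMascheroniConstant : ℂ) * Real.log x - (Real.pi : ℂ) ^ 2 / 6))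
    =O[𝓝[≠] (0 : ℂ)] (fun t : ℂ => t)

/-- The Kronecker limit formula for `Θ(r, r, t, x)` as `t → 1 - r` (`t` complex, `t ≠ 1 - r`). -/
def KroneckerLimitHigher (r : ℕ) (x : ℝ) : Prop :=
  (fun t : ℂ => Theta r r t x -
      (riemannZeta r * (1 + (x : ℂ) ^ (r - 1)) / (t - (1 - (r : ℂ)))
        + (x : ℂ) ^ (r - 1) * riemannZeta r * ((Real.eulerMascheroniConstant : ℂ) - Real.log x)
        + (Real.eulerMascheroniConstant : ℂ) * riemannZeta r
        + (x : ℂ) ^ (r - 1) * ∑ k ∈ Finset.Icc 1 (r - 2),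
            ((r - 1).choose k : ℂ) * (1 / (x : ℂ) ^ k)
              * riemannZeta ((r : ℂ) - k) * riemannZeta ((k : ℂ) + 1)))
    =O[𝓝[≠] (1 - (r : ℂ))] (fun t : ℂ => t - (1 - (r : ℂ)))

end HerglotzZagier

end

/-!
# Two-term functional equations and Kronecker limit formulas

In both parts the point of expansion, `t = 1 - r`, lies on the boundary of the half-plane where the
double series for `Θ(r, r, t, x)` converges, so that it is enough to continue the series a little
to the left and to read off the constant term.

**The case `r = 1`.** The partial fraction `1 / (n m) = 1 / (m (n + m x)) + x / (n (n + m x))`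
splits `Θ(1, 1, t, x)` into sums over `m` of Hurwitz zeta functions `ζ(1 + t, m x + 1)`, and the
same with `1 / x` for `x`. Subtracting the leading term `(m x) ^ (-t) / t` makes the sum over `m`
converge for `re t > -1 / 8`; `kernelSum` is this sum, multiplied by `t` to keep it free of poles.
It vanishes at `0`, and its derivative there is `-F x - ζ(2) / x` (`deriv_kernelSum_zero`), because
`ζ(1 + t, a) = 1 / t - ψ(a) + O(t)`. What was subtracted adds up to `(1 + x ^ (-t)) ζ(1 + t) / t`.
Hence the constant term of `Θ(1, 1, t, x)` is
`-F x - F (1 / x) - ζ(2) (x + 1 / x) + log² x / 2 - γ log x + 2 c`, with `c` the coefficient of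
`s - 1` in the Laurent expansion of `ζ` at `1` (`regularPartOne_zero`). At `x = 1` the kernel sum
can be weighted by a further factor `m ^ (-t)` without changing its derivative at `0`; the sum then
runs over ordered pairs and is evaluated by squaring the zeta series, which gives
`2 F 1 = 2 c - γ² - ζ(2)` (`two_mul_F_one`). Eliminating `c` turns the prescribed constant term
into the two-term equation.

**The case `r ≥ 2`.** Here both sides of the equivalence hold for every `x > 0`. For the limit
formula, `n ^ (-r) m ^ (-r) ((n + m x) ^ (-t) - n ^ (-t) - (m x) ^ (-t))` is summable for
`re t > 1 - r - 1 / 4`. At `t = 1 - r` it is a finite sum of products of powers by the binomial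
theorem (`reducedSum_one_sub`), and the two removed series are products of zeta values
(`kroneckerLimitHigher`). For the functional equation, the partial fraction expansion of `ψ`
expresses `F_r(x)` through the absolutely convergent sum of `x / (n ^ (r - 1) m (n x + m))`. The
combination with `1 / x` has `n x + m` as a factor of its numerator, and the quotient is a finite
sum of products of powers (`tsum_digammaTerm_add`, `twoTermHigherF`).
-/

namespace HerglotzZagier

/-! ### The digamma function on the positive reals -/

/-- The digamma function on the positive reals, as the derivative of `log Γ`. -/
noncomputable def realDigamma (y : ℝ) : ℝ := deriv (Real.log ∘ Real.Gamma) y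

theorem differentiableAt_log_Gamma {y : ℝ} (hy : 0 < y) :
    DifferentiableAt ℝ (Real.log ∘ Real.Gamma) y :=
  (Real.differentiableAt_Gamma fun m => by
    have : (0 : ℝ) ≤ m := m.cast_nonneg
    linarith).log (Real.Gamma_pos_of_pos hy).ne'

theorem digamma_ofReal {y : ℝ} (hy : 0 < y) : Complex.digamma (y : ℂ) = (realDigamma y : ℂ) := by
  have hR : DifferentiableAt ℝ Real.Gamma y := Real.differentiableAt_Gamma fun m => by
    have : (0 : ℝ) ≤ m := m.cast_nonneg
    linarith
  have hC : DifferentiableAt ℂ Complex.Gamma (y : ℂ) := Complex.differentiableAt_Gamma _ fun m => by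
    have h0 : (0 : ℝ) ≤ m := m.cast_nonneg
    intro h
    have := congrArg Complex.re h
    simp at this
    linarith
  have h1 := hC.hasDerivAt.comp_ofReal
  have h2 := hR.hasDerivAt.ofReal_comp
  have h3 : deriv Complex.Gamma (y : ℂ) = ((deriv Real.Gamma y : ℝ) : ℂ) := by
    refine h1.unique (h2.congr_of_eventuallyEq (Eventually.of_forall fun z => ?_))
    exact (Complex.Gamma_ofReal z)
  have h4 : realDigamma y = deriv Real.Gamma y / Real.Gamma y :=
    deriv.log hR (Real.Gamma_pos_of_pos hy).ne'
  rw [Complex.digamma_def, logDeriv_apply, h3, Complex.Gamma_ofReal, h4, Complex.ofReal_div]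

theorem realDigamma_one : realDigamma 1 = -Real.eulerMascheroniConstant := by
  have h := digamma_ofReal one_pos
  rw [Complex.ofReal_one, Complex.digamma_one] at h
  exact_mod_cast h.symm

theorem log_Gamma_add_one {y : ℝ} (hy : 0 < y) :
    (Real.log ∘ Real.Gamma) (y + 1) = (Real.log ∘ Real.Gamma) y + Real.log y := by
  simp only [Function.comp_apply, Real.Gamma_add_one hy.ne',
    Real.log_mul hy.ne' (Real.Gamma_pos_of_pos hy).ne', add_comm]

theorem realDigamma_add_one {y : ℝ} (hy : 0 < y) : realDigamma (y + 1) = realDigamma y + 1 / y := by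
  unfold realDigamma
  rw [← deriv_comp_add_const, one_div, ← Real.deriv_log,
    ← deriv_add (differentiableAt_log_Gamma hy) (Real.differentiableAt_log hy.ne')]
  apply EventuallyEq.deriv_eq
  filter_upwards [eventually_gt_nhds hy] with z hz using log_Gamma_add_one hz

/-- Convexity of `log Γ` compares its derivative with its increment `log y` over `[y, y + 1]`. -/
theorem realDigamma_le_log {y : ℝ} (hy : 0 < y) : realDigamma y ≤ Real.log y := by
  refine (Real.convexOn_log_Gamma.deriv_le_slope (y := y + 1) hy (by simp; linarith) (by linarith)
    (differentiableAt_log_Gamma hy)).trans (le_of_eq ?_)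
  rw [slope_def_field, log_Gamma_add_one hy]
  ring

theorem log_sub_inv_le_realDigamma {y : ℝ} (hy : 0 < y) :
    Real.log y - 1 / y ≤ realDigamma y := by
  have h := Real.convexOn_log_Gamma.slope_le_deriv (x := y) (y := y + 1) hy (by simp; linarith)
    (by linarith) (differentiableAt_log_Gamma (by linarith))
  rw [slope_def_field, log_Gamma_add_one hy] at h
  have h2 := realDigamma_add_one hy
  unfold realDigamma at *
  rw [h2] at h
  have : (Real.log ∘ Real.Gamma) y + Real.log y - (Real.log ∘ Real.Gamma) y = Real.log y := by ring
  rw [this] at h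
  simp only [add_sub_cancel_left, div_one] at h
  linarith

theorem tendsto_realDigamma_sub_log :
    Tendsto (fun y => realDigamma y - Real.log y) atTop (𝓝 0) := by
  have h0 : Tendsto (fun y : ℝ => -(1 / y)) atTop (𝓝 0) := by
    simpa using (tendsto_inv_atTop_zero (𝕜 := ℝ)).neg
  refine tendsto_of_tendsto_of_tendsto_of_le_of_le' h0 tendsto_const_nhds ?_ ?_
  · filter_upwards [eventually_gt_atTop 0] with y hy
    linarith [log_sub_inv_le_realDigamma hy]
  · filter_upwards [eventually_gt_atTop 0] with y hy
    linarith [realDigamma_le_log hy]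

/-- The partial sums telescope, since `1 / (y + n)` is an increment of the digamma function. For
`y = m x` the summands are, up to a factor `1 / m`, the derivatives of `kernelTerm` at `0`. -/
theorem tendsto_sum_inv_sub_log {y : ℝ} (hy : 0 < y) :
    Tendsto (fun N : ℕ => ∑ n ∈ Finset.range N,
      (1 / (y + n + 1) - Real.log (y + n + 1) + Real.log (y + n))) atTop
      (𝓝 (Real.log y - realDigamma y - 1 / y)) := by
  have hsum : ∀ N : ℕ, ∑ n ∈ Finset.range N,
      (1 / (y + n + 1) - Real.log (y + n + 1) + Real.log (y + n)) =
      (realDigamma (y + N) - Real.log (y + N)) + 1 / (y + N)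
        + (Real.log y - realDigamma y - 1 / y) := by
    intro N
    induction N with
    | zero => simp
    | succ N ih =>
      have hN : 0 < y + N := by positivity
      rw [Finset.sum_range_succ, ih]
      push_cast
      rw [show y + ((N : ℝ) + 1) = y + N + 1 by ring, realDigamma_add_one hN]
      ring
  have ht : Tendsto (fun N : ℕ => y + (N : ℝ)) atTop atTop :=
    tendsto_atTop_add_const_left _ _ tendsto_natCast_atTop_atTop
  have h1 := tendsto_realDigamma_sub_log.comp ht
  have h2 := (tendsto_inv_atTop_zero (𝕜 := ℝ)).comp ht
  have h3 := (h1.add h2).add_const (Real.log y - realDigamma y - 1 / y)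
  rw [add_zero, zero_add] at h3
  refine h3.congr fun N => ?_
  rw [hsum N]
  simp

/-- The partial fraction expansion of the digamma function. -/
theorem tendsto_sum_inv_sub_inv {y : ℝ} (hy : 0 < y) :
    Tendsto (fun N : ℕ => ∑ m ∈ Finset.range N, (1 / ((m : ℝ) + 1) - 1 / (y + m + 1))) atTop
      (𝓝 (realDigamma y + Real.eulerMascheroniConstant + 1 / y)) := by
  have hsum : ∀ {y : ℝ}, 0 < y → ∀ N : ℕ, ∑ m ∈ Finset.range N, 1 / (y + m + 1) =
      realDigamma (y + N + 1) - realDigamma (y + 1) := by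
    intro y hy N
    induction N with
    | zero => simp
    | succ N ih =>
      have hN : 0 < y + N + 1 := by positivity
      rw [Finset.sum_range_succ, ih]
      push_cast
      rw [show y + (N + 1 : ℝ) + 1 = (y + N + 1) + 1 by ring, realDigamma_add_one hN]
      ring
  have hsum1 : ∀ N : ℕ, ∑ m ∈ Finset.range N, 1 / ((m : ℝ) + 1) =
      realDigamma ((N : ℝ) + 1) - realDigamma 1 := by
    intro N
    induction N with
    | zero => simp
    | succ N ih =>
      have hN : 0 < (N : ℝ) + 1 := by positivity
      rw [Finset.sum_range_succ, ih]
      push_cast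
      rw [realDigamma_add_one hN]
      ring
  have hq : Tendsto (fun N : ℕ => (N : ℝ) + 1) atTop atTop :=
    tendsto_atTop_add_const_right _ _ tendsto_natCast_atTop_atTop
  have hp : Tendsto (fun N : ℕ => y + (N : ℝ) + 1) atTop atTop :=
    tendsto_atTop_add_const_right _ _
      (tendsto_atTop_add_const_left _ _ tendsto_natCast_atTop_atTop)
  have h1 := tendsto_realDigamma_sub_log.comp hq
  have h2 := tendsto_realDigamma_sub_log.comp hp
  have h3 : Tendsto (fun N : ℕ => Real.log (y + N + 1) - Real.log (N + 1)) atTop (𝓝 0) := by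
    have h4 : Tendsto (fun N : ℕ => 1 + y * ((N : ℝ) + 1)⁻¹) atTop (𝓝 (1 + y * 0)) :=
      ((tendsto_inv_atTop_zero.comp hq).const_mul y).const_add 1
    have h5 := (Real.continuousAt_log (by simp : (1 + y * 0 : ℝ) ≠ 0)).tendsto.comp h4
    simp only [mul_zero, add_zero, Real.log_one] at h5
    refine h5.congr fun N => ?_
    have hN : 0 < (N : ℝ) + 1 := by positivity
    have hN' : 0 < y + (N : ℝ) + 1 := by positivity
    rw [← Real.log_div hN'.ne' hN.ne']
    simp only [Function.comp_apply]
    congr 1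
    field_simp
    ring
  have h6 := ((h1.sub h2).sub h3).add_const
    (realDigamma y + Real.eulerMascheroniConstant + 1 / y)
  simp only [sub_zero, zero_add] at h6
  refine h6.congr fun N => ?_
  rw [Finset.sum_sub_distrib, hsum1, hsum hy, realDigamma_one, realDigamma_add_one hy]
  simp only [Function.comp_apply]
  ring

/-! ### Continuation of the double series and double sums of powers -/

/-- A meromorphic function on a half-plane that agrees with the double series on `𝒟` and has at
most one singularity `t₀`, outside `𝒟`, computes `Theta` away from `t₀`. -/
theorem Theta_eq_of_meromorphicOn {r s t₀ : ℂ} {x σ : ℝ} {G : ℂ → ℂ}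
    (hmer : MeromorphicOn G {t : ℂ | σ < t.re})
    (han : ∀ t : ℂ, σ < t.re → t ≠ t₀ → AnalyticAt ℂ G t)
    (hD : ∀ t : ℂ, (r, s, t) ∈ regionD → t ≠ t₀ ∧ G t = thetaSeries r s t x)
    {t : ℂ} (ht : σ < t.re) (ht₀ : t ≠ t₀) : Theta r s t x = G t := by
  set U : Set ℂ := {t : ℂ | σ < t.re}
  have hself : ∀ z : ℂ, z ≠ t₀ → toMeromorphicNFOn G U z = G z := by
    intro z hz
    by_cases hzU : z ∈ U
    · rw [toMeromorphicNFOn_eq_toMeromorphicNFAt hmer hzU,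
        toMeromorphicNFAt_eq_self.2 (han z hzU hz).meromorphicNFAt]
    · exact toMeromorphicNFOn_eq_self_on_compl hmer hzU
  have hc : IsThetaContinuation r s x σ (toMeromorphicNFOn G U) := by
    refine ⟨meromorphicNFOn_toMeromorphicNFOn G U, fun z hz => ?_⟩
    rw [hself z (hD z hz).1, (hD z hz).2]
  rw [Theta_eq_of_isThetaContinuation hc ht, hself t ht₀]

theorem norm_natCast_add_one_cpow (n : ℕ) (s : ℂ) :
    ‖((n : ℂ) + 1) ^ s‖ = ((n : ℝ) + 1) ^ s.re := by
  have h : ((n : ℂ) + 1) = (((n : ℝ) + 1 : ℝ) : ℂ) := by push_cast; rfl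
  rw [h, Complex.norm_cpow_eq_rpow_re_of_pos (by positivity)]

theorem summable_natCast_add_one_rpow {α : ℝ} (hα : 1 < α) :
    Summable fun n : ℕ => ((n : ℝ) + 1) ^ (-α) := by
  have h := (summable_nat_add_iff 1).2 (Real.summable_nat_rpow.2 (show -α < -1 by linarith))
  refine h.congr fun n => ?_
  push_cast
  rfl

theorem summable_mul_rpow {α β : ℝ} (hα : 1 < α) (hβ : 1 < β) :
    Summable fun p : ℕ × ℕ => ((p.1 : ℝ) + 1) ^ (-α) * ((p.2 : ℝ) + 1) ^ (-β) :=
  (summable_natCast_add_one_rpow hα).mul_of_nonneg (summable_natCast_add_one_rpow hβ)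
    (fun n => by positivity) (fun n => by positivity)

theorem hasSum_zeta_cpow {s : ℂ} (hs : 1 < s.re) :
    HasSum (fun n : ℕ => ((n : ℂ) + 1) ^ (-s)) (riemannZeta s) := by
  have hsum : Summable fun n : ℕ => ((n : ℂ) + 1) ^ (-s) := by
    refine Summable.of_norm ((summable_natCast_add_one_rpow hs).congr fun n => ?_)
    rw [norm_natCast_add_one_cpow, Complex.neg_re]
  have h := hsum.hasSum
  rw [zeta_eq_tsum_one_div_nat_add_one_cpow hs]
  convert h using 3 with n
  rw [Complex.cpow_neg, one_div]

theorem hasSum_zeta_mul_zeta {s w : ℂ} (hs : 1 < s.re) (hw : 1 < w.re) :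
    HasSum (fun p : ℕ × ℕ => ((p.1 : ℂ) + 1) ^ (-s) * ((p.2 : ℂ) + 1) ^ (-w))
      (riemannZeta s * riemannZeta w) := by
  have hsum : Summable fun p : ℕ × ℕ =>
      ((p.1 : ℂ) + 1) ^ (-s) * ((p.2 : ℂ) + 1) ^ (-w) := by
    refine Summable.of_norm_bounded (summable_mul_rpow hs hw) fun p => le_of_eq ?_
    simp only [norm_mul, norm_natCast_add_one_cpow, Complex.neg_re]
  have h := HasSum.mul (f := fun n : ℕ => ((n : ℂ) + 1) ^ (-s))
    (g := fun n : ℕ => ((n : ℂ) + 1) ^ (-w)) (hasSum_zeta_cpow hs) (hasSum_zeta_cpow hw) hsum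
  exact h

theorem hasSum_zeta_nat {k : ℕ} (hk : 1 < k) :
    HasSum (fun n : ℕ => (((n : ℂ) + 1) ^ k)⁻¹) (riemannZeta k) := by
  refine (hasSum_zeta_cpow (s := (k : ℂ)) (by simpa using hk)).congr_fun fun n => ?_
  rw [Complex.cpow_neg, Complex.cpow_natCast]

theorem hasSum_zeta_nat_mul {k l : ℕ} (hk : 1 < k) (hl : 1 < l) :
    HasSum (fun p : ℕ × ℕ => (((p.1 : ℂ) + 1) ^ k)⁻¹ * (((p.2 : ℂ) + 1) ^ l)⁻¹)
      (riemannZeta k * riemannZeta l) := by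
  refine (hasSum_zeta_mul_zeta (s := (k : ℂ)) (w := (l : ℂ)) (by simpa using hk)
    (by simpa using hl)).congr_fun fun n => ?_
  rw [Complex.cpow_neg, Complex.cpow_natCast, Complex.cpow_neg, Complex.cpow_natCast]

/-- Mean value inequality for complex powers of positive reals. -/
theorem norm_cpow_sub_cpow_le {p : ℂ} {u v M : ℝ} (hu : 0 < u) (huv : u ≤ v)
    (hM : ∀ w ∈ Set.Icc u v, w ^ (p.re - 1) ≤ M) :
    ‖(v : ℂ) ^ p - (u : ℂ) ^ p‖ ≤ ‖p‖ * M * (v - u) := by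
  have h := (convex_Icc u v).norm_image_sub_le_of_norm_hasDerivWithin_le
    (f := fun w : ℝ => (w : ℂ) ^ p) (f' := fun w : ℝ => p * (w : ℂ) ^ (p - 1))
    (C := ‖p‖ * M) ?_ ?_ (Set.left_mem_Icc.2 huv) (Set.right_mem_Icc.2 huv)
  · rwa [Real.norm_of_nonneg (sub_nonneg.2 huv)] at h
  · intro w hw
    have hw0 : w ≠ 0 := (hu.trans_le hw.1).ne'
    rcases eq_or_ne p 0 with rfl | hp
    · simpa using hasDerivWithinAt_const w (Set.Icc u v) (1 : ℂ)
    · exact (hasDerivAt_ofReal_cpow_const hw0 hp).hasDerivWithinAt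
  · intro w hw
    rw [norm_mul, Complex.norm_cpow_eq_rpow_re_of_pos (hu.trans_le hw.1)]
    simpa using mul_le_mul_of_nonneg_left (hM w hw) (norm_nonneg p)

/-! ### The double series for `r ≥ 2` -/

/-- `norm_add_cpow_sub_sub_le` in the case `b ≤ a`. The lower bound `c` on `a` and `b` is what lets
`re p` be arbitrarily negative. -/
theorem norm_add_cpow_sub_sub_le_of_le {p : ℂ} {a b c P R : ℝ} (hc : 0 < c) (hc1 : c ≤ 1)
    (hb : c ≤ b) (hba : b ≤ a) (hp : p.re ≤ P) (hP : 1 / 2 ≤ P) (hR : ‖p‖ ≤ R) :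
    ‖((a + b : ℝ) : ℂ) ^ p - (a : ℂ) ^ p - (b : ℂ) ^ p‖ ≤
      (R * 2 ^ (R + 1) + 1) * c ^ (-(P + R)) * (b ^ (1 / 2 : ℝ) * a ^ (P - 1 / 2)) := by
  have hb0 : 0 < b := hc.trans_le hb
  have ha0 : 0 < a := hb0.trans_le hba
  have hR0 : 0 ≤ R := (norm_nonneg p).trans hR
  have hre : |p.re| ≤ R := (Complex.abs_re_le_norm p).trans hR
  have hre1 : -R ≤ p.re := (abs_le.1 hre).1
  have hre2 : p.re ≤ R := (abs_le.1 hre).2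
  have key : ∀ u, c ≤ u → u ^ (p.re - 1 / 2) ≤ c ^ (-(P + R)) * u ^ (P - 1 / 2) := by
    intro u hu
    have hu0 : 0 < u := hc.trans_le hu
    have h1 : u ^ (p.re - 1 / 2) = u ^ (-(P - p.re)) * u ^ (P - 1 / 2) := by
      rw [← Real.rpow_add hu0]
      ring_nf
    rw [h1]
    gcongr
    calc u ^ (-(P - p.re)) ≤ c ^ (-(P - p.re)) :=
          Real.rpow_le_rpow_of_nonpos hc hu (by linarith)
      _ ≤ c ^ (-(P + R)) := Real.rpow_le_rpow_of_exponent_ge hc hc1 (by linarith)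
  have hbsplit : ∀ q : ℝ, b ^ q = b ^ (1 / 2 : ℝ) * b ^ (q - 1 / 2) := by
    intro q
    rw [← Real.rpow_add hb0]
    ring_nf
  -- the increment over `[a, a + b] ⊆ [a, 2a]`
  have h1 : ‖((a + b : ℝ) : ℂ) ^ p - (a : ℂ) ^ p‖ ≤
      R * 2 ^ (R + 1) * c ^ (-(P + R)) * (b ^ (1 / 2 : ℝ) * a ^ (P - 1 / 2)) := by
    have hmv := norm_cpow_sub_cpow_le (p := p) (u := a) (v := a + b)
      (M := 2 ^ (R + 1) * a ^ (p.re - 1)) ha0 (by linarith) (fun w hw => by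
        have hw1 : 1 ≤ w / a := (one_le_div ha0).2 hw.1
        have hw2 : w / a ≤ 2 := (div_le_iff₀ ha0).2 (by linarith [hw.2])
        have : w ^ (p.re - 1) = (w / a) ^ (p.re - 1) * a ^ (p.re - 1) := by
          rw [← Real.mul_rpow (by linarith) ha0.le, div_mul_cancel₀ _ ha0.ne']
        rw [this]
        gcongr
        calc (w / a) ^ (p.re - 1) ≤ (w / a) ^ (R + 1) :=
              Real.rpow_le_rpow_of_exponent_le hw1 (by linarith)
          _ ≤ 2 ^ (R + 1) := by gcongr)
    refine hmv.trans ?_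
    have hb2 : b * a ^ (p.re - 1) ≤ b ^ (1 / 2 : ℝ) * (c ^ (-(P + R)) * a ^ (P - 1 / 2)) := by
      calc b * a ^ (p.re - 1)
          = b ^ (1 / 2 : ℝ) * (b ^ (1 / 2 : ℝ) * a ^ (p.re - 1)) := by
            rw [← mul_assoc, ← Real.rpow_add hb0]; norm_num
        _ ≤ b ^ (1 / 2 : ℝ) * (a ^ (1 / 2 : ℝ) * a ^ (p.re - 1)) := by gcongr
        _ = b ^ (1 / 2 : ℝ) * a ^ (p.re - 1 / 2) := by
            rw [← Real.rpow_add ha0]; ring_nf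
        _ ≤ _ := by gcongr; exact key a (hb.trans hba)
    calc ‖p‖ * (2 ^ (R + 1) * a ^ (p.re - 1)) * (a + b - a)
        = ‖p‖ * 2 ^ (R + 1) * (b * a ^ (p.re - 1)) := by ring
      _ ≤ R * 2 ^ (R + 1) * (b ^ (1 / 2 : ℝ) * (c ^ (-(P + R)) * a ^ (P - 1 / 2))) := by
          gcongr
      _ = _ := by ring
  have h2 : ‖(b : ℂ) ^ p‖ ≤ c ^ (-(P + R)) * (b ^ (1 / 2 : ℝ) * a ^ (P - 1 / 2)) := by
    rw [Complex.norm_cpow_eq_rpow_re_of_pos hb0, hbsplit]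
    calc b ^ (1 / 2 : ℝ) * b ^ (p.re - 1 / 2)
        ≤ b ^ (1 / 2 : ℝ) * (c ^ (-(P + R)) * b ^ (P - 1 / 2)) := by gcongr; exact key b hb
      _ ≤ b ^ (1 / 2 : ℝ) * (c ^ (-(P + R)) * a ^ (P - 1 / 2)) := by
          gcongr
      _ = _ := by ring
  calc _ ≤ _ := norm_sub_le _ _
    _ ≤ _ := add_le_add h1 h2
    _ = _ := by ring

/-- The defect of additivity of `u ↦ u ^ p` is smaller than `(max a b) ^ P` by a factor of order
`(min a b / max a b) ^ (1 / 2)`, uniformly for bounded `p` with `re p ≤ P`. -/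
theorem norm_add_cpow_sub_sub_le {p : ℂ} {a b c P R : ℝ} (hc : 0 < c) (hc1 : c ≤ 1)
    (ha : c ≤ a) (hb : c ≤ b) (hp : p.re ≤ P) (hP : 1 / 2 ≤ P) (hR : ‖p‖ ≤ R) :
    ‖((a + b : ℝ) : ℂ) ^ p - (a : ℂ) ^ p - (b : ℂ) ^ p‖ ≤
      (R * 2 ^ (R + 1) + 1) * c ^ (-(P + R)) *
        (b ^ (1 / 2 : ℝ) * a ^ (P - 1 / 2) + a ^ (1 / 2 : ℝ) * b ^ (P - 1 / 2)) := by
  have hb0 : 0 < b := hc.trans_le hb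
  have ha0 : 0 < a := hc.trans_le ha
  have hR0 : 0 ≤ R := (norm_nonneg p).trans hR
  rcases le_total b a with h | h
  · refine (norm_add_cpow_sub_sub_le_of_le hc hc1 hb h hp hP hR).trans ?_
    gcongr
    exact le_add_of_nonneg_right (by positivity)
  · have := norm_add_cpow_sub_sub_le_of_le hc hc1 ha h hp hP hR
    rw [add_comm b a, sub_right_comm] at this
    refine this.trans ?_
    gcongr
    exact le_add_of_nonneg_left (by positivity)

/-- The summand of `Θ(r, r, t, x)` with the leading behaviours `n ^ (-t)` and `(m x) ^ (-t)` of
`(n + m x) ^ (-t)` removed. -/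
noncomputable def reducedTerm (r : ℕ) (x : ℝ) (p : ℕ × ℕ) (t : ℂ) : ℂ :=
  (((p.1 : ℂ) + 1) ^ r)⁻¹ * (((p.2 : ℂ) + 1) ^ r)⁻¹ *
    ((((p.1 : ℂ) + 1) + ((p.2 : ℂ) + 1) * (x : ℂ)) ^ (-t) - ((p.1 : ℂ) + 1) ^ (-t)
      - (((p.2 : ℂ) + 1) * (x : ℂ)) ^ (-t))

/-- The sum of the reduced terms over all pairs of positive integers. -/
noncomputable def reducedSum (r : ℕ) (x : ℝ) (t : ℂ) : ℂ := ∑' p : ℕ × ℕ, reducedTerm r x p t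

/-- A summable bound, uniform for bounded `t` in the half-plane. -/
theorem exists_norm_reducedTerm_le {r : ℕ} (hr : 1 < r) {x : ℝ} (hx : 0 < x) (R : ℝ) :
    ∃ C : ℝ, ∀ (p : ℕ × ℕ) (t : ℂ), 1 - r - 1 / 4 < t.re → ‖t‖ ≤ R →
      ‖reducedTerm r x p t‖ ≤
        C * (((p.1 : ℝ) + 1) ^ (-(5 / 4) : ℝ) * ((p.2 : ℝ) + 1) ^ (-(5 / 4) : ℝ)) := by
  set c : ℝ := min 1 x
  have hc : 0 < c := lt_min one_pos hx
  -- the supremum of `re (-t)` over the half-plane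
  set P : ℝ := r - 3 / 4 with hP
  have hr2 : (2 : ℝ) ≤ r := by exact_mod_cast hr
  refine ⟨(R * 2 ^ (R + 1) + 1) * c ^ (-(P + R)) * (x ^ (1 / 2 : ℝ) + x ^ (P - 1 / 2)), ?_⟩
  intro p t ht htR
  set n : ℝ := (p.1 : ℝ) + 1 with hn
  set m : ℝ := (p.2 : ℝ) + 1 with hm
  have hn1 : 1 ≤ n := by simp [hn]
  have hm1 : 1 ≤ m := by simp [hm]
  have hn0 : 0 < n := by linarith
  have hm0 : 0 < m := by linarith
  have hR0 : 0 ≤ R := (norm_nonneg t).trans htR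
  have hb := norm_add_cpow_sub_sub_le (p := -t) (a := n) (b := m * x) (P := P) (R := R) hc
    (min_le_left _ _) ((min_le_left _ _).trans hn1)
    ((min_le_right _ _).trans (by nlinarith)) (by rw [Complex.neg_re]; linarith) (by linarith)
    (by rwa [norm_neg])
  have heq : reducedTerm r x p t = (((n ^ r)⁻¹ * (m ^ r)⁻¹ : ℝ) : ℂ) *
      (((n + m * x : ℝ) : ℂ) ^ (-t) - (n : ℂ) ^ (-t) - ((m * x : ℝ) : ℂ) ^ (-t)) := by
    simp only [reducedTerm, hn, hm]
    push_cast
    rfl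
  rw [heq, norm_mul, Complex.norm_real, Real.norm_of_nonneg (by positivity)]
  have hpow : ∀ u : ℝ, 0 < u → ∀ q : ℝ, (u ^ r)⁻¹ * u ^ q = u ^ (q - r) := by
    intro u hu q
    rw [Real.rpow_sub hu, Real.rpow_natCast]
    field_simp
  have hle : ∀ u : ℝ, 1 ≤ u → u ^ ((1 / 2 : ℝ) - r) ≤ u ^ (-(5 / 4) : ℝ) := fun u hu =>
    Real.rpow_le_rpow_of_exponent_le hu (by linarith)
  have hP2 : P - 1 / 2 - r = -(5 / 4) := by rw [hP]; ring
  calc (n ^ r)⁻¹ * (m ^ r)⁻¹ * _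
      ≤ (n ^ r)⁻¹ * (m ^ r)⁻¹ * ((R * 2 ^ (R + 1) + 1) * c ^ (-(P + R)) *
        ((m * x) ^ (1 / 2 : ℝ) * n ^ (P - 1 / 2) + n ^ (1 / 2 : ℝ) * (m * x) ^ (P - 1 / 2))) := by
        gcongr
    _ = (R * 2 ^ (R + 1) + 1) * c ^ (-(P + R)) *
        (x ^ (1 / 2 : ℝ) * (((n ^ r)⁻¹ * n ^ (P - 1 / 2)) * ((m ^ r)⁻¹ * m ^ (1 / 2 : ℝ))) +
          x ^ (P - 1 / 2) * (((n ^ r)⁻¹ * n ^ (1 / 2 : ℝ)) * ((m ^ r)⁻¹ * m ^ (P - 1 / 2)))) := by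
        rw [Real.mul_rpow hm0.le hx.le, Real.mul_rpow hm0.le hx.le]
        ring
    _ ≤ (R * 2 ^ (R + 1) + 1) * c ^ (-(P + R)) *
        (x ^ (1 / 2 : ℝ) * (n ^ (-(5 / 4) : ℝ) * m ^ (-(5 / 4) : ℝ)) +
          x ^ (P - 1 / 2) * (n ^ (-(5 / 4) : ℝ) * m ^ (-(5 / 4) : ℝ))) := by
        rw [hpow n hn0, hpow n hn0, hpow m hm0, hpow m hm0, hP2]
        gcongr _ * (_ * (_ * ?_) + _ * (?_ * _))
        · exact hle m hm1
        · exact hle n hn1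
    _ = _ := by ring

theorem differentiable_const_cpow_neg {u : ℂ} (hu : u ≠ 0) :
    Differentiable ℂ fun t : ℂ => u ^ (-t) := fun _ =>
  (differentiableAt_id.neg).const_cpow (Or.inl hu)

theorem natCast_add_one_ne_zero (n : ℕ) : ((n : ℂ) + 1) ≠ 0 := Nat.cast_add_one_ne_zero n

theorem natCast_add_mul_ne_zero (n m : ℕ) {x : ℝ} (hx : 0 < x) :
    ((n : ℂ) + 1) + ((m : ℂ) + 1) * (x : ℂ) ≠ 0 := by
  have h : (0 : ℝ) < ((n : ℝ) + 1) + ((m : ℝ) + 1) * x := by positivity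
  exact_mod_cast h.ne'

theorem differentiable_reducedTerm (r : ℕ) {x : ℝ} (hx : 0 < x) (p : ℕ × ℕ) :
    Differentiable ℂ (reducedTerm r x p) := by
  have hx' : (x : ℂ) ≠ 0 := by exact_mod_cast hx.ne'
  exact (((differentiable_const_cpow_neg (natCast_add_mul_ne_zero p.1 p.2 hx)).sub
    (differentiable_const_cpow_neg (natCast_add_one_ne_zero p.1))).sub
    (differentiable_const_cpow_neg (mul_ne_zero (natCast_add_one_ne_zero p.2) hx'))).const_mul _

theorem summable_reducedTerm {r : ℕ} (hr : 1 < r) {x : ℝ} (hx : 0 < x) {t : ℂ}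
    (ht : 1 - r - 1 / 4 < t.re) : Summable fun p => reducedTerm r x p t := by
  obtain ⟨C, hC⟩ := exists_norm_reducedTerm_le hr hx ‖t‖
  exact Summable.of_norm_bounded
    ((summable_mul_rpow (α := 5 / 4) (β := 5 / 4) (by norm_num) (by norm_num)).mul_left C)
    fun p => hC p t ht le_rfl

theorem isOpen_halfPlane (σ : ℝ) : IsOpen {t : ℂ | σ < t.re} :=
  isOpen_lt continuous_const Complex.continuous_re

theorem differentiableOn_reducedSum {r : ℕ} (hr : 1 < r) {x : ℝ} (hx : 0 < x) :
    DifferentiableOn ℂ (reducedSum r x) {t : ℂ | 1 - r - 1 / 4 < t.re} := by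
  intro t ht
  obtain ⟨C, hC⟩ := exists_norm_reducedTerm_le hr hx (‖t‖ + 1)
  have hU : IsOpen ({t : ℂ | 1 - r - 1 / 4 < t.re} ∩ Metric.ball 0 (‖t‖ + 1)) :=
    (isOpen_halfPlane _).inter Metric.isOpen_ball
  have h := Complex.differentiableOn_tsum_of_summable_norm (F := fun p => reducedTerm r x p)
    ((summable_mul_rpow (α := 5 / 4) (β := 5 / 4) (by norm_num) (by norm_num)).mul_left C)
    (fun p => (differentiable_reducedTerm r hx p).differentiableOn) hU
    (fun p w hw => hC p w hw.1 (by simpa using (Metric.mem_ball.1 hw.2).le))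
  refine (h.differentiableAt (hU.mem_nhds ⟨ht, by simp⟩)).differentiableWithinAt

/-- On `𝒟` the double series is the sum of the reduced terms plus the two removed series, which
are products of zeta values. -/
theorem thetaSeries_eq_reducedSum_add {r : ℕ} (hr : 1 < r) {x : ℝ} (hx : 0 < x) {t : ℂ}
    (ht : 1 < ((r : ℂ) + t).re) :
    thetaSeries r r t x = reducedSum r x t +
      riemannZeta r * riemannZeta (r + t) * (1 + (x : ℂ) ^ (-t)) := by
  have hrt : 1 - r - 1 / 4 < t.re := by
    simp only [Complex.add_re, Complex.natCast_re] at ht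
    linarith
  have hr1 : 1 < ((r : ℂ)).re := by simpa using hr
  have h0 := (summable_reducedTerm hr hx hrt).hasSum
  have h1 := hasSum_zeta_mul_zeta ht hr1
  have h2 := (hasSum_zeta_mul_zeta hr1 ht).mul_right ((x : ℂ) ^ (-t))
  have h3 := (h0.add h1).add h2
  have h4 : HasSum (fun p : ℕ × ℕ => 1 / (((p.1 : ℂ) + 1) ^ (r : ℂ) * ((p.2 : ℂ) + 1) ^ (r : ℂ) *
      (((p.1 : ℂ) + 1) + ((p.2 : ℂ) + 1) * (x : ℂ)) ^ t))
      (reducedSum r x t + riemannZeta (r + t) * riemannZeta r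
        + riemannZeta r * riemannZeta (r + t) * (x : ℂ) ^ (-t)) := by
    refine h3.congr_fun fun p => ?_
    have hm : (((p.2 : ℂ) + 1) * (x : ℂ)) ^ (-t) = ((p.2 : ℂ) + 1) ^ (-t) * (x : ℂ) ^ (-t) := by
      have := Complex.mul_cpow_ofReal_nonneg (a := (p.2 : ℝ) + 1) (b := x) (by positivity) hx.le
        (-t)
      push_cast at this
      exact this
    have hn0 := natCast_add_one_ne_zero p.1
    have hm0 := natCast_add_one_ne_zero p.2
    have e1 : ((p.1 : ℂ) + 1) ^ (-((r : ℂ) + t)) =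
        (((p.1 : ℂ) + 1) ^ r)⁻¹ * ((p.1 : ℂ) + 1) ^ (-t) := by
      rw [neg_add, Complex.cpow_add _ _ hn0, Complex.cpow_neg, Complex.cpow_natCast]
    have e2 : ((p.2 : ℂ) + 1) ^ (-((r : ℂ) + t)) =
        (((p.2 : ℂ) + 1) ^ r)⁻¹ * ((p.2 : ℂ) + 1) ^ (-t) := by
      rw [neg_add, Complex.cpow_add _ _ hm0, Complex.cpow_neg, Complex.cpow_natCast]
    have e3 : ((p.1 : ℂ) + 1) ^ (-(r : ℂ)) = (((p.1 : ℂ) + 1) ^ r)⁻¹ := by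
      rw [Complex.cpow_neg, Complex.cpow_natCast]
    have e4 : ((p.2 : ℂ) + 1) ^ (-(r : ℂ)) = (((p.2 : ℂ) + 1) ^ r)⁻¹ := by
      rw [Complex.cpow_neg, Complex.cpow_natCast]
    rw [e1, e2, e3, e4, reducedTerm, hm, Complex.cpow_natCast, Complex.cpow_natCast, one_div,
      mul_inv, mul_inv, ← Complex.cpow_neg _ t]
    ring
  have h5 := h4.summable.tsum_prod
  rw [h4.tsum_eq] at h5
  rw [thetaSeries, ← h5]
  ring

/-- At `t = 1 - r` the binomial theorem turns each reduced term into a finite sum of products. -/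
theorem reducedSum_one_sub {r : ℕ} (hr : 1 < r) {x : ℝ} (hx : 0 < x) :
    reducedSum r x (1 - r) = (x : ℂ) ^ (r - 1) * ∑ k ∈ Finset.Icc 1 (r - 2),
      ((r - 1).choose k : ℂ) * (1 / (x : ℂ) ^ k)
        * riemannZeta ((r : ℂ) - k) * riemannZeta ((k : ℂ) + 1) := by
  have hx' : (x : ℂ) ≠ 0 := by exact_mod_cast hx.ne'
  have h : HasSum (fun p : ℕ × ℕ => ∑ k ∈ Finset.Icc 1 (r - 2),
      (x : ℂ) ^ (r - 1) * (((r - 1).choose k : ℂ) * (1 / (x : ℂ) ^ k)) *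
        ((((p.1 : ℂ) + 1) ^ (r - k))⁻¹ * (((p.2 : ℂ) + 1) ^ (k + 1))⁻¹))
      (∑ k ∈ Finset.Icc 1 (r - 2), (x : ℂ) ^ (r - 1) * (((r - 1).choose k : ℂ) * (1 / (x : ℂ) ^ k))
        * (riemannZeta ((r - k : ℕ) : ℂ) * riemannZeta ((k + 1 : ℕ) : ℂ))) := by
    refine hasSum_sum fun k hk => ?_
    rw [Finset.mem_Icc] at hk
    exact (hasSum_zeta_nat_mul (k := r - k) (l := k + 1) (by omega) (by omega)).mul_left _
  have h2 : reducedSum r x (1 - r) = _ := (h.congr_fun fun p => ?_).tsum_eq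
  · rw [h2, Finset.mul_sum]
    refine Finset.sum_congr rfl fun k hk => ?_
    rw [Finset.mem_Icc] at hk
    rw [Nat.cast_sub (by omega)]
    push_cast
    ring
  · have hn0 := natCast_add_one_ne_zero p.1
    have hm0 := natCast_add_one_ne_zero p.2
    obtain ⟨d, rfl⟩ : ∃ d, r = d + 2 := ⟨r - 2, by omega⟩
    have hexp : (-(1 - ((d + 2 : ℕ) : ℂ))) = ((d + 1 : ℕ) : ℂ) := by push_cast; ring
    simp only [reducedTerm, hexp, Complex.cpow_natCast]
    generalize (p.1 : ℂ) + 1 = n at *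
    generalize (p.2 : ℂ) + 1 = m at *
    -- the first and last binomial terms are the removed powers `(m x) ^ (r - 1)`, `n ^ (r - 1)`
    rw [add_pow, Finset.sum_range_succ, Finset.sum_range_succ']
    have hI : Finset.Icc 1 (d + 2 - 2) = Finset.Ico 1 (d + 1) := by
      ext; simp [Finset.mem_Icc, Finset.mem_Ico]
    rw [hI, Finset.sum_Ico_eq_sum_range]
    simp only [Nat.add_sub_cancel, pow_zero, Nat.sub_self, Nat.choose_zero_right, Nat.choose_self,
      Nat.cast_one, mul_one, one_mul, Nat.sub_zero]
    rw [show ∀ S A B : ℂ, S + A + B - B - A = S by intros; ring, Finset.mul_sum]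
    refine Finset.sum_congr rfl fun k hk => ?_
    rw [Finset.mem_range] at hk
    obtain ⟨e, rfl⟩ : ∃ e, d = k + 1 + e := ⟨d - (k + 1), by omega⟩
    have a1 : k + 1 + e + 2 - (k + 1) = e + 2 := by omega
    have a2 : k + 1 + e + 2 - 1 = k + 1 + e + 1 := by omega
    have a3 : k + 1 + e + 1 - (k + 1) = e + 1 := by omega
    simp only [a1, a2, a3, add_comm 1 k]
    rw [mul_pow]
    field_simp
    ring

/-! ### The Kronecker limit formula for `r ≥ 2` -/

theorem differentiable_dslope {f : ℂ → ℂ} (hf : Differentiable ℂ f) (a : ℂ) :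
    Differentiable ℂ (dslope f a) := by
  rw [← differentiableOn_univ]
  exact (Complex.differentiableOn_dslope univ_mem).2 hf.differentiableOn

theorem hasDerivAt_ofReal_cpow_neg {x : ℝ} (hx : 0 < x) (t : ℂ) :
    HasDerivAt (fun t : ℂ => (x : ℂ) ^ (-t)) (-((x : ℂ) ^ (-t) * (Real.log x : ℂ))) t := by
  have hx' : (x : ℂ) ≠ 0 := by exact_mod_cast hx.ne'
  have h := (hasDerivAt_neg t).const_cpow (Or.inl hx' : (x : ℂ) ≠ 0 ∨ -t ≠ 0)
  rw [← Complex.ofReal_log hx.le] at h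
  convert h using 1
  ring

theorem differentiable_one_add_cpow_neg {x : ℝ} (hx : 0 < x) :
    Differentiable ℂ fun t : ℂ => 1 + (x : ℂ) ^ (-t) := fun t =>
  ((hasDerivAt_ofReal_cpow_neg hx t).const_add 1).differentiableAt

/-- The part of `Θ(r, r, t, x)` that is regular at `t = 1 - r`. -/
noncomputable def regularPart (r : ℕ) (x : ℝ) (t : ℂ) : ℂ :=
  reducedSum r x t + riemannZeta r *
    (riemannZeta₀ (r + t) * (1 + (x : ℂ) ^ (-t))
      + dslope (fun t : ℂ => 1 + (x : ℂ) ^ (-t)) (1 - r) t)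

theorem analyticAt_regularPart {r : ℕ} (hr : 1 < r) {x : ℝ} (hx : 0 < x) {t : ℂ}
    (ht : 1 - r - 1 / 4 < t.re) : AnalyticAt ℂ (regularPart r x) t := by
  have h1 : AnalyticAt ℂ (reducedSum r x) t :=
    (differentiableOn_reducedSum hr hx).analyticAt ((isOpen_halfPlane _).mem_nhds ht)
  have hA := differentiable_one_add_cpow_neg hx
  have h2 : Differentiable ℂ fun t : ℂ => riemannZeta r *
      (riemannZeta₀ (r + t) * (1 + (x : ℂ) ^ (-t))
        + dslope (fun t : ℂ => 1 + (x : ℂ) ^ (-t)) (1 - r) t) :=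
    (((differentiable_riemannZeta₀.comp (differentiable_id.const_add _)).mul hA).add
      (differentiable_dslope hA _)).const_mul _
  exact h1.add (h2.analyticAt t)

theorem Theta_eq_regularPart_add {r : ℕ} (hr : 1 < r) {x : ℝ} (hx : 0 < x) {t : ℂ}
    (ht : 1 - r - 1 / 4 < t.re) (ht₀ : t ≠ 1 - r) :
    Theta r r t x = regularPart r x t +
      riemannZeta r * (1 + (x : ℂ) ^ (r - 1)) / (t - (1 - (r : ℂ))) := by
  have hsub : ∀ z : ℂ, AnalyticAt ℂ (fun t : ℂ => t - (1 - (r : ℂ))) z := fun z =>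
    analyticAt_id.sub analyticAt_const
  refine Theta_eq_of_meromorphicOn (t₀ := 1 - r) (σ := 1 - r - 1 / 4)
    (G := fun t => regularPart r x t +
      riemannZeta r * (1 + (x : ℂ) ^ (r - 1)) / (t - (1 - (r : ℂ)))) ?_ ?_ ?_ ht ht₀
  · intro z hz
    exact (analyticAt_regularPart hr hx hz).meromorphicAt.add
      (analyticAt_const.meromorphicAt.div (hsub z).meromorphicAt)
  · intro z hz hz₀
    exact (analyticAt_regularPart hr hx hz).add
      (analyticAt_const.div (hsub z) (sub_ne_zero.2 hz₀))
  · intro z hz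
    have hz1 : 1 < ((r : ℂ) + z).re := hz.1
    have hz₀ : z ≠ 1 - r := by
      rintro rfl
      simp at hz1
    refine ⟨hz₀, ?_⟩
    have hne : (r : ℂ) + z ≠ 1 := fun h => hz₀ (by rw [← h]; ring)
    have hpow : (x : ℂ) ^ (-(1 - (r : ℂ))) = (x : ℂ) ^ (r - 1) := by
      rw [← Complex.cpow_natCast, Nat.cast_sub hr.le]
      push_cast
      ring_nf
    -- the `dslope` in the regular part absorbs `1 + x ^ (-t)` times the pole of `ζ`, up to a
    -- multiple of `1 / (t - (1 - r))`
    have hd := sub_smul_dslope (fun t : ℂ => 1 + (x : ℂ) ^ (-t)) (1 - r) z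
    rw [smul_eq_mul, hpow] at hd
    have hd2 : dslope (fun t : ℂ => 1 + (x : ℂ) ^ (-t)) (1 - r) z =
        ((x : ℂ) ^ (-z) - (x : ℂ) ^ (r - 1)) / (z - (1 - r)) := by
      rw [eq_div_iff (sub_ne_zero.2 hz₀), mul_comm, hd]
      ring
    rw [thetaSeries_eq_reducedSum_add hr hx hz1, riemannZeta_eq_inv_sub_add hne, regularPart, hd2]
    have e : (r : ℂ) + z - 1 = z - (1 - r) := by ring
    rw [e]
    have := sub_ne_zero.2 hz₀
    field_simp
    ring

/-- The Kronecker limit formula for `r ≥ 2` holds unconditionally. -/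
theorem kroneckerLimitHigher {r : ℕ} (hr : 1 < r) {x : ℝ} (hx : 0 < x) :
    KroneckerLimitHigher r x := by
  have hx' : (x : ℂ) ≠ 0 := by exact_mod_cast hx.ne'
  have hre : 1 - (r : ℝ) - 1 / 4 < (1 - (r : ℂ)).re := by simp
  have hO := (analyticAt_regularPart hr hx hre).differentiableAt.isBigO_sub
  have hpow : (x : ℂ) ^ (-(1 - (r : ℂ))) = (x : ℂ) ^ (r - 1) := by
    rw [← Complex.cpow_natCast, Nat.cast_sub hr.le]
    push_cast
    ring_nf
  have hval : regularPart r x (1 - r) =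
      (x : ℂ) ^ (r - 1) * riemannZeta r * ((Real.eulerMascheroniConstant : ℂ) - Real.log x)
        + (Real.eulerMascheroniConstant : ℂ) * riemannZeta r
        + (x : ℂ) ^ (r - 1) * ∑ k ∈ Finset.Icc 1 (r - 2),
            ((r - 1).choose k : ℂ) * (1 / (x : ℂ) ^ k)
              * riemannZeta ((r : ℂ) - k) * riemannZeta ((k : ℂ) + 1) := by
    rw [regularPart, reducedSum_one_sub hr hx, dslope_same,
      ((hasDerivAt_ofReal_cpow_neg hx _).const_add 1).deriv, hpow, add_sub_cancel,
      riemannZeta₀_one]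
    ring
  refine (hO.mono nhdsWithin_le_nhds).congr' ?_ EventuallyEq.rfl
  have hU := (isOpen_halfPlane (1 - (r : ℝ) - 1 / 4)).mem_nhds hre
  filter_upwards [mem_nhdsWithin_of_mem_nhds hU, self_mem_nhdsWithin] with t ht ht₀
  rw [Theta_eq_regularPart_add hr hx ht ht₀, hval]
  ring

/-! ### The functional equation for `r ≥ 2` -/

theorem hasSum_realDigamma {y : ℝ} (hy : 0 < y) :
    HasSum (fun m : ℕ => y / (((m : ℝ) + 1) * (y + ((m : ℝ) + 1))))
      (realDigamma y + Real.eulerMascheroniConstant + 1 / y) := by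
  rw [hasSum_iff_tendsto_nat_of_nonneg (fun m => by positivity)]
  refine (tendsto_sum_inv_sub_inv hy).congr fun N => Finset.sum_congr rfl fun m _ => ?_
  have h1 : (m : ℝ) + 1 ≠ 0 := by positivity
  have h2 : y + m + 1 ≠ 0 := by positivity
  have h3 : y + (m + 1 : ℝ) ≠ 0 := by positivity
  field_simp
  ring

theorem rpow_mul_rpow_le_add_rpow {a b p q : ℝ} (ha : 0 < a) (hb : 0 < b) (hp : 0 ≤ p)
    (hq : 0 ≤ q) : a ^ p * b ^ q ≤ (a + b) ^ (p + q) := by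
  rw [Real.rpow_add (by positivity)]
  gcongr <;> linarith

/-- The summand `x / (n ^ (r - 1) m (n x + m))` of the double series that `F_r` reduces to. -/
noncomputable def digammaTerm (r : ℕ) (x : ℝ) (p : ℕ × ℕ) : ℝ :=
  x / (((p.1 : ℝ) + 1) ^ (r - 1) * ((p.2 : ℝ) + 1) * (((p.1 : ℝ) + 1) * x + ((p.2 : ℝ) + 1)))

theorem summable_digammaTerm {r : ℕ} (hr : 1 < r) {x : ℝ} (hx : 0 < x) :
    Summable (digammaTerm r x) := by
  refine Summable.of_nonneg_of_le (fun p => by unfold digammaTerm; positivity) (fun p => ?_)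
    ((summable_mul_rpow (α := 3 / 2) (β := 3 / 2) (by norm_num) (by norm_num)).mul_left
      (x * x ^ (-(1 / 2) : ℝ)))
  unfold digammaTerm
  set n : ℝ := (p.1 : ℝ) + 1 with hn
  set m : ℝ := (p.2 : ℝ) + 1 with hm
  have hn1 : 1 ≤ n := by simp [hn]
  have hm1 : 1 ≤ m := by simp [hm]
  have hn0 : 0 < n := by linarith
  have hm0 : 0 < m := by linarith
  have h1 : n ≤ n ^ (r - 1) := le_self_pow₀ hn1 (by omega)
  have h2 := rpow_mul_rpow_le_add_rpow (a := n * x) (b := m) (p := 1 / 2) (q := 1 / 2)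
    (by positivity) hm0 (by norm_num) (by norm_num)
  norm_num at h2
  have hneg : ∀ u : ℝ, 0 < u → u ^ (-(3 / 2) : ℝ) = (u * u ^ (1 / 2 : ℝ))⁻¹ := by
    intro u hu
    rw [Real.rpow_neg hu.le]
    congr 1
    rw [show (3 / 2 : ℝ) = 1 + 1 / 2 by norm_num, Real.rpow_add hu, Real.rpow_one]
  calc x / (n ^ (r - 1) * m * (n * x + m)) ≤ x / (n * m * ((n * x) ^ (1 / 2 : ℝ) * m ^ (1 / 2 : ℝ)))
        := by gcongr
    _ = x * x ^ (-(1 / 2) : ℝ) * (n ^ (-(3 / 2) : ℝ) * m ^ (-(3 / 2) : ℝ)) := by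
        rw [hneg n hn0, hneg m hm0, Real.mul_rpow hn0.le hx.le, Real.rpow_neg hx.le]
        field_simp

theorem higherF_eq_tsum {r : ℕ} (hr : 1 < r) {x : ℝ} (hx : 0 < x) :
    higherF r x = (∑' p, digammaTerm r x p : ℝ) - Real.eulerMascheroniConstant * riemannZeta r
      - riemannZeta ((r : ℂ) + 1) / x := by
  have hx' : (x : ℂ) ≠ 0 := by exact_mod_cast hx.ne'
  have h0 := (summable_digammaTerm hr hx).hasSum.prod_fiberwise (fun n => by
    have h := (hasSum_realDigamma (y := ((n : ℝ) + 1) * x) (by positivity)).mul_left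
      ((((n : ℝ) + 1) ^ r)⁻¹)
    refine h.congr_fun fun m => ?_
    obtain ⟨d, rfl⟩ : ∃ d, r = d + 2 := ⟨r - 2, by omega⟩
    unfold digammaTerm
    rw [show d + 2 - 1 = d + 1 by omega]
    field_simp
    ring)
  have h1 := (Complex.hasSum_ofReal.2 h0)
  have h2 := (hasSum_zeta_nat hr).mul_left (Real.eulerMascheroniConstant : ℂ)
  have h3 := (hasSum_zeta_nat (k := r + 1) (by omega)).div_const (x : ℂ)
  have h4 := (h1.sub h2).sub h3
  rw [higherF, ← Nat.cast_add_one, ← h4.tsum_eq]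
  refine tsum_congr fun n => ?_
  have hn0 := natCast_add_one_ne_zero n
  have hd := digamma_ofReal (y := ((n : ℝ) + 1) * x) (by positivity)
  push_cast at hd ⊢
  rw [hd]
  field_simp
  ring

/-- A geometric sum divides out the factor `n x + m`, so that the two double series add up to
products of zeta values. -/
theorem tsum_digammaTerm_add {r : ℕ} (hr : 1 < r) {x : ℝ} (hx : 0 < x) :
    ((∑' p, digammaTerm r x p : ℝ) : ℂ) +
      (-(x : ℂ)) ^ (r - 1) * ((∑' p, digammaTerm r (1 / x) p : ℝ) : ℂ) =
      -∑ i ∈ Finset.range (r - 2), (-(x : ℂ)) ^ (i + 1) *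
        (riemannZeta ((r - 1 - i : ℕ) : ℂ) * riemannZeta ((i + 2 : ℕ) : ℂ)) := by
  have hx' : (x : ℂ) ≠ 0 := by exact_mod_cast hx.ne'
  have h1 := Complex.hasSum_ofReal.2 (summable_digammaTerm hr hx).hasSum
  have h2 := (Complex.hasSum_ofReal.2
    ((Equiv.prodComm ℕ ℕ).hasSum_iff.2
      (summable_digammaTerm hr (one_div_pos.2 hx)).hasSum)).mul_left ((-(x : ℂ)) ^ (r - 1))
  have h3 : HasSum (fun p : ℕ × ℕ => ∑ i ∈ Finset.range (r - 2), (-(x : ℂ)) ^ (i + 1) *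
      ((((p.1 : ℂ) + 1) ^ (r - 1 - i))⁻¹ * (((p.2 : ℂ) + 1) ^ (i + 2))⁻¹))
      (∑ i ∈ Finset.range (r - 2), (-(x : ℂ)) ^ (i + 1) *
        (riemannZeta ((r - 1 - i : ℕ) : ℂ) * riemannZeta ((i + 2 : ℕ) : ℂ))) := by
    refine hasSum_sum fun i hi => ?_
    rw [Finset.mem_range] at hi
    exact (hasSum_zeta_nat_mul (by omega) (by omega)).mul_left _
  refine (h1.add h2).unique (h3.neg.congr_fun fun p => ?_)
  have hn0 := natCast_add_one_ne_zero p.1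
  have hm0 := natCast_add_one_ne_zero p.2
  have hnm : ((p.1 : ℂ) + 1) * x + ((p.2 : ℂ) + 1) ≠ 0 := by
    have h : (0 : ℝ) < ((p.1 : ℝ) + 1) * x + ((p.2 : ℝ) + 1) := by positivity
    exact_mod_cast h.ne'
  simp only [digammaTerm, Function.comp_apply, Equiv.prodComm_apply, Prod.fst_swap, Prod.snd_swap]
  push_cast
  generalize (p.1 : ℂ) + 1 = n at *
  generalize (p.2 : ℂ) + 1 = m at *
  obtain ⟨d, rfl⟩ : ∃ d, r = d + 2 := ⟨r - 2, by omega⟩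
  simp only [Nat.add_sub_cancel, show d + 2 - 1 = d + 1 by omega]
  have hg := geom_sum₂_mul (-(x : ℂ) * n) m d
  have hsum : ∑ i ∈ Finset.range d, (-(x : ℂ)) ^ (i + 1) * ((n ^ (d + 1 - i))⁻¹ * (m ^ (i + 2))⁻¹)
      = -(x : ℂ) / (n ^ (d + 1) * m ^ (d + 1)) *
        ∑ i ∈ Finset.range d, (-(x : ℂ) * n) ^ i * m ^ (d - 1 - i) := by
    rw [Finset.mul_sum]
    refine Finset.sum_congr rfl fun i hi => ?_
    rw [Finset.mem_range] at hi
    obtain ⟨e, rfl⟩ : ∃ e, d = i + 1 + e := ⟨d - (i + 1), by omega⟩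
    rw [show i + 1 + e + 1 - i = e + 2 by omega, show i + 1 + e - 1 - i = e by omega, mul_pow]
    field_simp
    ring
  rw [hsum]
  have hg2 : ∑ i ∈ Finset.range d, (-(x : ℂ) * n) ^ i * m ^ (d - 1 - i) =
      (m ^ d - (-(x : ℂ) * n) ^ d) / (n * x + m) := by
    rw [eq_div_iff hnm]
    linear_combination -hg
  have hmn : m * (1 / (x : ℂ)) + n = (n * x + m) / x := by
    field_simp
    ring
  rw [hg2, hmn, mul_pow]
  field_simp
  ring

/-- The two-term functional equation for `r ≥ 2` holds unconditionally. -/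
theorem twoTermHigherF {r : ℕ} (hr : 1 < r) {x : ℝ} (hx : 0 < x) : TwoTermHigherF r x := by
  have hx' : (x : ℂ) ≠ 0 := by exact_mod_cast hx.ne'
  have h1 := higherF_eq_tsum hr hx
  have h2 := higherF_eq_tsum hr (one_div_pos.2 hx)
  have h3 := tsum_digammaTerm_add hr hx
  obtain ⟨d, rfl⟩ : ∃ d, r = d + 2 := ⟨r - 2, by omega⟩
  have hI : Finset.Icc 1 (d + 2) = Finset.Ico 1 (d + 2 + 1) := by
    ext
    simp only [Finset.mem_Icc, Finset.mem_Ico]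
    omega
  rw [Complex.ofReal_div, Complex.ofReal_one] at h2
  unfold TwoTermHigherF
  rw [h1, h2, hI, Finset.sum_Ico_eq_sum_range]
  simp only [Nat.add_sub_cancel, show d + 2 - 1 = d + 1 by omega] at h3 ⊢
  rw [Finset.sum_range_succ, Finset.sum_range_succ']
  have hmid : ∑ k ∈ Finset.range d, zetaValue (1 + (k + 1)) *
      zetaValue (d + 2 - (1 + (k + 1)) + 1) * (-(x : ℂ)) ^ (1 + (k + 1) - 1) =
      ∑ i ∈ Finset.range d, (-(x : ℂ)) ^ (i + 1) *
        (riemannZeta ((d + 1 - i : ℕ) : ℂ) * riemannZeta ((i + 2 : ℕ) : ℂ)) := by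
    refine Finset.sum_congr rfl fun i hi => ?_
    rw [Finset.mem_range] at hi
    rw [show d + 2 - (1 + (i + 1)) + 1 = d + 1 - i by omega, show 1 + (i + 1) - 1 = i + 1 by omega,
      show 1 + (i + 1) = i + 2 by omega, zetaValue, zetaValue, if_neg (by omega),
      if_neg (by omega)]
    ring
  rw [hmid]
  have hz1 : zetaValue 1 = Real.eulerMascheroniConstant := if_pos rfl
  have hz2 : zetaValue (d + 2) = riemannZeta ((d + 2 : ℕ) : ℂ) := if_neg (by omega)
  simp only [add_zero, show 1 + (d + 1) = d + 2 by omega, show d + 2 - 1 = d + 1 by omega,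
    hz1, hz2, Nat.sub_self, pow_zero]
  rw [div_div_eq_mul_div, div_one]
  linear_combination h3

/-! ### The regularized Hurwitz kernel -/

/-- The difference between `t * (u + 1) ^ (-1 - t)` and the integral of `t * w ^ (-1 - t)` over
`[u, u + 1]`, bounded through the derivative of the integrand. -/
theorem norm_mul_cpow_sub_add_le {t : ℂ} {u M : ℝ} (hu : 0 < u)
    (hM : ∀ w ∈ Set.Icc u (u + 1), w ^ (-2 - t.re) ≤ M) :
    ‖t * ((u + 1 : ℝ) : ℂ) ^ (-1 - t) - (u : ℂ) ^ (-t) + ((u + 1 : ℝ) : ℂ) ^ (-t)‖ ≤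
      ‖t‖ * (‖1 + t‖ * M) := by
  have hle : u ≤ u + 1 := by linarith
  rcases eq_or_ne t 0 with rfl | ht
  · simp
  have hM0 : 0 ≤ M := (Real.rpow_nonneg hu.le _).trans (hM u (Set.left_mem_Icc.2 hle))
  set b : ℂ := ((u + 1 : ℝ) : ℂ) ^ (-1 - t) with hb
  have h := (convex_Icc u (u + 1)).norm_image_sub_le_of_norm_hasDerivWithin_le
    (f := fun w : ℝ => (w : ℂ) ^ (-t) + t * b * (w : ℂ))
    (f' := fun w : ℝ => -t * (w : ℂ) ^ (-t - 1) + t * b)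
    (C := ‖t‖ * (‖1 + t‖ * M)) ?_ ?_ (Set.left_mem_Icc.2 hle) (Set.right_mem_Icc.2 hle)
  · have e1 : ‖u + 1 - u‖ = 1 := by simp
    rw [e1, mul_one] at h
    have e2 : t * b - (u : ℂ) ^ (-t) + ((u + 1 : ℝ) : ℂ) ^ (-t) =
        ((u + 1 : ℝ) : ℂ) ^ (-t) + t * b * ((u + 1 : ℝ) : ℂ) - ((u : ℂ) ^ (-t) + t * b * u) := by
      push_cast
      ring
    rw [e2]
    exact h
  · intro w hw
    have hw0 : w ≠ 0 := (hu.trans_le hw.1).ne'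
    have h1 := hasDerivAt_ofReal_cpow_const hw0 (neg_ne_zero.2 ht)
    have h2 : HasDerivAt (fun w : ℝ => t * b * (w : ℂ)) (t * b * 1) w :=
      (Complex.ofRealCLM.hasDerivAt (x := w)).const_mul (t * b)
    rw [mul_one] at h2
    exact (h1.add h2).hasDerivWithinAt
  · intro w hw
    have hw0 : 0 < w := hu.trans_le hw.1
    have h1 := norm_cpow_sub_cpow_le (p := -1 - t) (u := w) (v := u + 1) (M := M) hw0 hw.2
      (fun z hz => by
        have := hM z ⟨hw.1.trans hz.1, hz.2⟩
        convert this using 2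
        simp only [Complex.sub_re, Complex.neg_re, Complex.one_re]
        ring)
    have e : -t * (w : ℂ) ^ (-t - 1) + t * b = t * (b - (w : ℂ) ^ (-1 - t)) := by
      rw [show -t - 1 = -1 - t by ring]
      ring
    rw [e, norm_mul]
    refine mul_le_mul_of_nonneg_left ?_ (norm_nonneg t)
    refine h1.trans ?_
    have e2 : ‖-1 - t‖ = ‖1 + t‖ := by rw [← norm_neg]; ring_nf
    rw [e2]
    exact mul_le_of_le_one_right (by positivity) (by linarith [hw.1])

/-- The summand `m ^ (-1 - ε t) (t (a + 1) ^ (-1 - t) - a ^ (-t) + (a + 1) ^ (-t))` at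
`a = m x + n`, where `m ≥ 1` and `n ≥ 0` (so that `p.1 = m - 1` and `p.2 = n`). For fixed `m` its
sum over `n` is `m ^ (-1 - ε t)` times the regularization `t ζ(1 + t, m x + 1) - (m x) ^ (-t)` of
the Hurwitz zeta function. The exponent `ε` serves the two cases `ε = 0` and `ε = 1`. -/
noncomputable def kernelTerm (ε x : ℝ) (p : ℕ × ℕ) (t : ℂ) : ℂ :=
  ((p.1 : ℂ) + 1) ^ (-(1 + ε * t)) *
    (t * (((p.1 : ℂ) + 1) * x + p.2 + 1) ^ (-1 - t) - (((p.1 : ℂ) + 1) * x + p.2) ^ (-t)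
      + (((p.1 : ℂ) + 1) * x + p.2 + 1) ^ (-t))

/-- The sum of the kernel terms over all `m ≥ 1` and `n ≥ 0`. -/
noncomputable def kernelSum (ε x : ℝ) (t : ℂ) : ℂ := ∑' p : ℕ × ℕ, kernelTerm ε x p t

/-- A summable bound, uniform for bounded `t` in the half-plane. -/
theorem exists_norm_kernelTerm_le {ε x : ℝ} (hε : 0 ≤ ε) (hε1 : ε ≤ 1) (hx : 0 < x) (R : ℝ) :
    ∃ C : ℝ, ∀ (p : ℕ × ℕ) (t : ℂ), -(1 / 8) < t.re → ‖t‖ ≤ R →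
      ‖kernelTerm ε x p t‖ ≤
        C * (((p.1 : ℝ) + 1) ^ (-(11 / 8) : ℝ) * ((p.2 : ℝ) + 1) ^ (-(11 / 8) : ℝ)) := by
  set c : ℝ := min 1 (x / 2)
  have hc : 0 < c := lt_min one_pos (by linarith)
  have hc1 : c ≤ 1 := min_le_left _ _
  have hcx : c ≤ x / 2 := min_le_right _ _
  refine ⟨R * ((1 + R) * c ^ (-2 - R)), ?_⟩
  intro p t ht htR
  set m : ℝ := (p.1 : ℝ) + 1 with hm
  set k : ℝ := (p.2 : ℝ) + 1 with hk
  have hp2 : (0 : ℝ) ≤ p.2 := Nat.cast_nonneg _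
  have hm1 : 1 ≤ m := by simp [hm]
  have hk1 : 1 ≤ k := by simp [hk]
  have hm0 : 0 < m := by linarith
  have hk0 : 0 < k := by linarith
  have hR0 : 0 ≤ R := (norm_nonneg t).trans htR
  have hre : t.re ≤ R := (Complex.re_le_norm t).trans htR
  set u : ℝ := m * x + p.2 with hu
  have hu0 : 0 < u := by positivity
  have hcu : c * (m + k) ≤ u := by
    rw [hu, hk]
    nlinarith
  -- the decay `w ^ (-15 / 8)` is shared out so that `m`, with its weight, and `k` both get `-11 / 8`
  have hM : ∀ w ∈ Set.Icc u (u + 1),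
      w ^ (-2 - t.re) ≤ c ^ (-2 - R) * (m ^ (-(1 / 2) : ℝ) * k ^ (-(11 / 8) : ℝ)) := by
    intro w hw
    have h1 := rpow_mul_rpow_le_add_rpow (p := 1 / 2) (q := 11 / 8) hm0 hk0 (by norm_num)
      (by norm_num)
    calc w ^ (-2 - t.re) ≤ (c * (m + k)) ^ (-2 - t.re) :=
          Real.rpow_le_rpow_of_nonpos (by positivity) (hcu.trans hw.1) (by linarith)
      _ = c ^ (-2 - t.re) * (m + k) ^ (-2 - t.re) := Real.mul_rpow hc.le (by positivity)
      _ ≤ c ^ (-2 - R) * (m + k) ^ (-(1 / 2 + 11 / 8) : ℝ) := by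
          gcongr ?_ * ?_
          · exact Real.rpow_le_rpow_of_exponent_ge hc hc1 (by linarith)
          · exact Real.rpow_le_rpow_of_exponent_le (by linarith) (by linarith)
      _ ≤ _ := by
          rw [Real.rpow_neg (by positivity), Real.rpow_neg hm0.le, Real.rpow_neg hk0.le,
            ← mul_inv]
          gcongr
  have hb := norm_mul_cpow_sub_add_le hu0 hM
  have hw : ‖((p.1 : ℂ) + 1) ^ (-(1 + ε * t))‖ ≤ m ^ (-(7 / 8) : ℝ) := by
    rw [norm_natCast_add_one_cpow]
    refine Real.rpow_le_rpow_of_exponent_le hm1 ?_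
    simp only [Complex.neg_re, Complex.add_re, Complex.one_re, Complex.re_ofReal_mul]
    nlinarith
  have heq : kernelTerm ε x p t = ((p.1 : ℂ) + 1) ^ (-(1 + ε * t)) *
      (t * ((u + 1 : ℝ) : ℂ) ^ (-1 - t) - (u : ℂ) ^ (-t) + ((u + 1 : ℝ) : ℂ) ^ (-t)) := by
    simp only [kernelTerm, hu, hm]
    push_cast
    rfl
  have h1t : ‖1 + t‖ ≤ 1 + R := (norm_add_le _ _).trans (by rw [norm_one]; linarith)
  have hmm : m ^ (-(11 / 8) : ℝ) = m ^ (-(7 / 8) : ℝ) * m ^ (-(1 / 2) : ℝ) := by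
    rw [← Real.rpow_add hm0]
    norm_num
  rw [heq, norm_mul, hmm]
  calc _ ≤ m ^ (-(7 / 8) : ℝ) * (‖t‖ * (‖1 + t‖ *
        (c ^ (-2 - R) * (m ^ (-(1 / 2) : ℝ) * k ^ (-(11 / 8) : ℝ))))) := by gcongr
    _ ≤ m ^ (-(7 / 8) : ℝ) * (R * ((1 + R) *
        (c ^ (-2 - R) * (m ^ (-(1 / 2) : ℝ) * k ^ (-(11 / 8) : ℝ))))) := by gcongr
    _ = _ := by ring

theorem natCast_mul_add_ne_zero (m n : ℕ) {x : ℝ} (hx : 0 < x) :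
    ((m : ℂ) + 1) * x + n ≠ 0 := by
  have h : (0 : ℝ) < ((m : ℝ) + 1) * x + n := by positivity
  exact_mod_cast h.ne'

theorem natCast_mul_add_add_one_ne_zero (m n : ℕ) {x : ℝ} (hx : 0 < x) :
    ((m : ℂ) + 1) * x + n + 1 ≠ 0 := by
  have h : (0 : ℝ) < ((m : ℝ) + 1) * x + n + 1 := by positivity
  exact_mod_cast h.ne'

theorem differentiable_kernelTerm (ε : ℝ) {x : ℝ} (hx : 0 < x) (p : ℕ × ℕ) :
    Differentiable ℂ (kernelTerm ε x p) := by
  have ha := natCast_mul_add_ne_zero p.1 p.2 hx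
  have ha1 := natCast_mul_add_add_one_ne_zero p.1 p.2 hx
  have h1 : Differentiable ℂ fun t : ℂ => ((p.1 : ℂ) + 1) ^ (-(1 + ε * t)) := fun t =>
    (((differentiableAt_id.const_mul (ε : ℂ)).const_add 1).neg).const_cpow
      (Or.inl (natCast_add_one_ne_zero p.1))
  have h2 : Differentiable ℂ fun t : ℂ => (((p.1 : ℂ) + 1) * x + p.2 + 1) ^ (-1 - t) := fun t =>
    (differentiableAt_id.const_sub (-1 : ℂ)).const_cpow (Or.inl ha1)
  exact h1.mul (((differentiable_id.mul h2).sub (differentiable_const_cpow_neg ha)).add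
    (differentiable_const_cpow_neg ha1))

theorem summable_kernelBound (C : ℝ) : Summable fun p : ℕ × ℕ =>
    C * (((p.1 : ℝ) + 1) ^ (-(11 / 8) : ℝ) * ((p.2 : ℝ) + 1) ^ (-(11 / 8) : ℝ)) :=
  (summable_mul_rpow (by norm_num) (by norm_num)).mul_left C

theorem summable_kernelTerm {ε x : ℝ} (hε : 0 ≤ ε) (hε1 : ε ≤ 1) (hx : 0 < x) {t : ℂ}
    (ht : -(1 / 8) < t.re) : Summable fun p => kernelTerm ε x p t := by
  obtain ⟨C, hC⟩ := exists_norm_kernelTerm_le hε hε1 hx ‖t‖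
  exact Summable.of_norm_bounded (summable_kernelBound C) fun p => hC p t ht le_rfl

theorem differentiableOn_kernelSum {ε x : ℝ} (hε : 0 ≤ ε) (hε1 : ε ≤ 1) (hx : 0 < x) :
    DifferentiableOn ℂ (kernelSum ε x) {t : ℂ | -(1 / 8) < t.re} := by
  intro t ht
  obtain ⟨C, hC⟩ := exists_norm_kernelTerm_le hε hε1 hx (‖t‖ + 1)
  have hU : IsOpen ({t : ℂ | -(1 / 8) < t.re} ∩ Metric.ball 0 (‖t‖ + 1)) :=
    (isOpen_halfPlane _).inter Metric.isOpen_ball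
  have h := Complex.differentiableOn_tsum_of_summable_norm (F := fun p => kernelTerm ε x p)
    (summable_kernelBound C)
    (fun p => (differentiable_kernelTerm ε hx p).differentiableOn) hU
    (fun p w hw => hC p w hw.1 (by simpa using (Metric.mem_ball.1 hw.2).le))
  exact (h.differentiableAt (hU.mem_nhds ⟨ht, by simp⟩)).differentiableWithinAt

theorem kernelSum_zero (ε x : ℝ) : kernelSum ε x 0 = 0 := by
  simp [kernelSum, kernelTerm]

theorem deriv_kernelTerm_zero (ε : ℝ) {x : ℝ} (hx : 0 < x) (p : ℕ × ℕ) :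
    deriv (kernelTerm ε x p) 0 = ((((p.1 : ℝ) + 1)⁻¹ *
      (1 / (((p.1 : ℝ) + 1) * x + p.2 + 1) - Real.log (((p.1 : ℝ) + 1) * x + p.2 + 1)
        + Real.log (((p.1 : ℝ) + 1) * x + p.2)) : ℝ) : ℂ) := by
  have ha := natCast_mul_add_ne_zero p.1 p.2 hx
  have ha1 := natCast_mul_add_add_one_ne_zero p.1 p.2 hx
  have hneg : HasDerivAt (fun t : ℂ => -1 - t) (-1) 0 := by
    simpa using (hasDerivAt_id (0 : ℂ)).const_sub (-1)
  have h1 : HasDerivAt (fun t : ℂ => ((p.1 : ℂ) + 1) ^ (-(1 + ε * t))) _ 0 :=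
    ((((hasDerivAt_id (0 : ℂ)).const_mul (ε : ℂ)).const_add 1).neg).const_cpow
      (Or.inl (natCast_add_one_ne_zero p.1))
  have h2 := (hasDerivAt_id (0 : ℂ)).mul
    (hneg.const_cpow (c := ((p.1 : ℂ) + 1) * x + p.2 + 1) (Or.inl ha1))
  have h3 := (hasDerivAt_neg (0 : ℂ)).const_cpow (c := ((p.1 : ℂ) + 1) * x + p.2) (Or.inl ha)
  have h4 := (hasDerivAt_neg (0 : ℂ)).const_cpow (c := ((p.1 : ℂ) + 1) * x + p.2 + 1)
    (Or.inl ha1)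
  have h5 := h1.mul ((h2.sub h3).add h4)
  have l1 : Complex.log (((p.1 : ℂ) + 1) * x + p.2) =
      (Real.log (((p.1 : ℝ) + 1) * x + p.2) : ℂ) := by
    rw [Complex.ofReal_log (by positivity)]
    push_cast
    rfl
  have l2 : Complex.log (((p.1 : ℂ) + 1) * x + p.2 + 1) =
      (Real.log (((p.1 : ℝ) + 1) * x + p.2 + 1) : ℂ) := by
    rw [Complex.ofReal_log (by positivity)]
    push_cast
    rfl
  refine (HasDerivAt.deriv (f := kernelTerm ε x p) h5).trans ?_
  rw [l1, l2]
  simp only [id, neg_zero, Complex.cpow_zero, zero_mul, mul_zero, add_zero, sub_zero, one_mul,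
    Complex.cpow_neg_one, Pi.sub_apply, Pi.add_apply, Pi.mul_apply]
  push_cast
  ring

/-- The derivative of the kernel sum at `0` is the Herglotz–Zagier function up to an elementary
term, whatever the weight `ε`. -/
theorem deriv_kernelSum_zero {ε x : ℝ} (hε : 0 ≤ ε) (hε1 : ε ≤ 1) (hx : 0 < x) :
    deriv (kernelSum ε x) 0 = -F x - riemannZeta 2 / x := by
  have hx' : (x : ℂ) ≠ 0 := by exact_mod_cast hx.ne'
  obtain ⟨C, hC⟩ := exists_norm_kernelTerm_le hε hε1 hx 1
  have hU : IsOpen ({t : ℂ | -(1 / 8) < t.re} ∩ Metric.ball 0 1) :=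
    (isOpen_halfPlane _).inter Metric.isOpen_ball
  have h := Complex.hasSum_deriv_of_summable_norm (F := fun p => kernelTerm ε x p) (z := 0)
    (summable_kernelBound C)
    (fun p => (differentiable_kernelTerm ε hx p).differentiableOn) hU
    (fun p w hw => hC p w hw.1 (by simpa using (Metric.mem_ball.1 hw.2).le))
    ⟨by norm_num, by simp⟩
  have h1 := h.congr_fun (fun p => (deriv_kernelTerm_zero ε hx p).symm)
  have hfib : ∀ m : ℕ, HasSum (fun n : ℕ => ((((m : ℝ) + 1)⁻¹ *
      (1 / (((m : ℝ) + 1) * x + n + 1) - Real.log (((m : ℝ) + 1) * x + n + 1)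
        + Real.log (((m : ℝ) + 1) * x + n)) : ℝ) : ℂ))
      ((((m : ℝ) + 1)⁻¹ * (Real.log (((m : ℝ) + 1) * x) - realDigamma (((m : ℝ) + 1) * x)
        - 1 / (((m : ℝ) + 1) * x)) : ℝ) : ℂ) := by
    intro m
    have hs := Complex.summable_ofReal.1 (h1.summable.prod_factor m)
    have ht := (tendsto_sum_inv_sub_log (y := ((m : ℝ) + 1) * x) (by positivity)).const_mul
      (((m : ℝ) + 1)⁻¹)
    simp only [Finset.mul_sum] at ht
    have := tendsto_nhds_unique hs.hasSum.tendsto_sum_nat ht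
    exact Complex.hasSum_ofReal.2 (this ▸ hs.hasSum)
  have h2 := h1.prod_fiberwise hfib
  have hz : HasSum (fun n : ℕ => (((n : ℂ) + 1) ^ 2)⁻¹) (riemannZeta 2) := by
    exact_mod_cast hasSum_zeta_nat (k := 2) (by norm_num)
  have h3 := (h2.add (hz.div_const (x : ℂ))).neg
  have h4 : F x = -(deriv (kernelSum ε x) 0 + riemannZeta 2 / x) := by
    rw [F]
    refine Eq.trans (tsum_congr fun m => ?_) h3.tsum_eq
    have hn0 := natCast_add_one_ne_zero m
    have hd := digamma_ofReal (y := ((m : ℝ) + 1) * x) (by positivity)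
    have hl := Complex.ofReal_log (x := ((m : ℝ) + 1) * x) (by positivity)
    push_cast at hd hl ⊢
    rw [hd, hl]
    field_simp
    ring
  rw [h4]
  ring

/-! ### The kernel sum for `re t > 0` and the value `F 1` -/

/-- The summand `m ^ (-1 - ε t) (m x + n) ^ (-1 - t)` with `m, n ≥ 1`. -/
noncomputable def shiftTerm (ε x : ℝ) (t : ℂ) (p : ℕ × ℕ) : ℂ :=
  ((p.1 : ℂ) + 1) ^ (-(1 + ε * t)) * (((p.1 : ℂ) + 1) * x + p.2 + 1) ^ (-1 - t)

theorem summable_shiftTerm {ε x : ℝ} (hε : 0 ≤ ε) (hx : 0 < x) {t : ℂ} (ht : 0 < t.re) :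
    Summable (shiftTerm ε x t) := by
  refine Summable.of_norm_bounded ((summable_mul_rpow (α := 1 + t.re / 2) (β := 1 + t.re / 2)
    (by linarith) (by linarith)).mul_left (x ^ (-(t.re / 2)))) fun p => ?_
  set m : ℝ := (p.1 : ℝ) + 1 with hm
  set k : ℝ := (p.2 : ℝ) + 1 with hk
  have hm1 : 1 ≤ m := by simp [hm]
  have hm0 : 0 < m := by linarith
  have hk0 : 0 < k := by positivity
  have h1 : ‖((p.1 : ℂ) + 1) ^ (-(1 + ε * t))‖ ≤ m ^ (-1 : ℝ) := by
    rw [norm_natCast_add_one_cpow]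
    refine Real.rpow_le_rpow_of_exponent_le hm1 ?_
    simp only [Complex.neg_re, Complex.add_re, Complex.one_re, Complex.re_ofReal_mul]
    nlinarith [mul_nonneg hε ht.le]
  have h2 : ‖(((p.1 : ℂ) + 1) * x + p.2 + 1) ^ (-1 - t)‖ = (m * x + k) ^ (-1 - t.re) := by
    have e : (((p.1 : ℂ) + 1) * x + p.2 + 1) = ((m * x + k : ℝ) : ℂ) := by
      rw [hm, hk]
      push_cast
      ring
    rw [e, Complex.norm_cpow_eq_rpow_re_of_pos (by positivity)]
    simp
  have h3 := rpow_mul_rpow_le_add_rpow (a := m * x) (b := k) (p := t.re / 2) (q := 1 + t.re / 2)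
    (by positivity) hk0 (by linarith) (by linarith)
  rw [shiftTerm, norm_mul, h2]
  calc _ ≤ m ^ (-1 : ℝ) * ((m * x) ^ (t.re / 2) * k ^ (1 + t.re / 2))⁻¹ := by
        rw [show -1 - t.re = -(t.re / 2 + (1 + t.re / 2)) by ring, Real.rpow_neg (by positivity)]
        gcongr
    _ = _ := by
        rw [Real.mul_rpow hm0.le hx.le, Real.rpow_neg hx.le, Real.rpow_neg hk0.le, neg_add,
          Real.rpow_add hm0, Real.rpow_neg hm0.le (t.re / 2), mul_inv, mul_inv]
        ring

theorem tendsto_natCast_add_cpow_neg {a : ℝ} (ha : 0 < a) {t : ℂ} (ht : 0 < t.re) :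
    Tendsto (fun N : ℕ => ((a : ℂ) + N) ^ (-t)) atTop (𝓝 0) := by
  rw [tendsto_zero_iff_norm_tendsto_zero]
  have h1 : Tendsto (fun N : ℕ => a + (N : ℝ)) atTop atTop :=
    tendsto_atTop_add_const_left _ _ tendsto_natCast_atTop_atTop
  refine ((tendsto_rpow_neg_atTop ht).comp h1).congr fun N => ?_
  have e : (a : ℂ) + N = ((a + N : ℝ) : ℂ) := by push_cast; rfl
  rw [e, Complex.norm_cpow_eq_rpow_re_of_pos (by positivity)]
  simp

theorem ofReal_mul_natCast_cpow {x : ℝ} (hx : 0 < x) (m : ℕ) (s : ℂ) :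
    (((m : ℂ) + 1) * x) ^ s = ((m : ℂ) + 1) ^ s * (x : ℂ) ^ s := by
  have := Complex.mul_cpow_ofReal_nonneg (a := (m : ℝ) + 1) (b := x) (by positivity) hx.le s
  push_cast at this
  exact this

/-- For `re t > 0` the differences in the kernel telescope. -/
theorem kernelSum_eq {ε x : ℝ} (hε : 0 ≤ ε) (hε1 : ε ≤ 1) (hx : 0 < x) {t : ℂ} (ht : 0 < t.re) :
    kernelSum ε x t = t * ∑' p, shiftTerm ε x t p -
      (x : ℂ) ^ (-t) * riemannZeta (1 + (1 + ε) * t) := by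
  have hK := (summable_kernelTerm hε hε1 hx (t := t) (by linarith)).hasSum
  have hL := (summable_shiftTerm hε hx ht).hasSum.mul_left t
  have h1 : HasSum (fun p : ℕ × ℕ => ((p.1 : ℂ) + 1) ^ (-(1 + ε * t)) *
      ((((p.1 : ℂ) + 1) * x + p.2) ^ (-t) - (((p.1 : ℂ) + 1) * x + p.2 + 1) ^ (-t)))
      (t * ∑' p, shiftTerm ε x t p - kernelSum ε x t) := by
    refine (hL.sub hK).congr_fun fun p => ?_
    rw [kernelTerm, shiftTerm]
    ring
  have hfib : ∀ m : ℕ, HasSum (fun n : ℕ => ((m : ℂ) + 1) ^ (-(1 + ε * t)) *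
      ((((m : ℂ) + 1) * x + n) ^ (-t) - (((m : ℂ) + 1) * x + n + 1) ^ (-t)))
      (((m : ℂ) + 1) ^ (-(1 + ε * t)) * (((m : ℂ) + 1) * x) ^ (-t)) := by
    intro m
    have hs := h1.summable.prod_factor m
    have ht' : Tendsto (fun N : ℕ => ∑ n ∈ Finset.range N, ((m : ℂ) + 1) ^ (-(1 + ε * t)) *
      ((((m : ℂ) + 1) * x + n) ^ (-t) - (((m : ℂ) + 1) * x + n + 1) ^ (-t))) atTop
      (𝓝 (((m : ℂ) + 1) ^ (-(1 + ε * t)) * (((m : ℂ) + 1) * x) ^ (-t))) := by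
      have h2 := tendsto_natCast_add_cpow_neg (a := ((m : ℝ) + 1) * x) (by positivity) ht
      have h3 := (h2.const_sub ((((m : ℂ) + 1) * x) ^ (-t))).const_mul
        (((m : ℂ) + 1) ^ (-(1 + ε * t)))
      rw [sub_zero] at h3
      refine h3.congr fun N => ?_
      rw [← Finset.mul_sum]
      congr 1
      have h4 := Finset.sum_range_sub' (fun n : ℕ => (((m : ℂ) + 1) * x + n) ^ (-t)) N
      simp only [Nat.cast_add, Nat.cast_one, Nat.cast_zero, add_zero, ← add_assoc] at h4
      rw [h4]
      push_cast
      rfl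
    exact tendsto_nhds_unique hs.hasSum.tendsto_sum_nat ht' ▸ hs.hasSum
  have h2 := h1.prod_fiberwise hfib
  have hre : 1 < (1 + (1 + (ε : ℂ)) * t).re := by
    have : (1 + (1 + (ε : ℂ)) * t).re = 1 + (1 + ε) * t.re := by simp
    rw [this]
    nlinarith [mul_nonneg hε ht.le]
  have h3 := (hasSum_zeta_cpow hre).mul_left ((x : ℂ) ^ (-t))
  have h4 := h2.unique (h3.congr_fun fun m => ?_)
  · linear_combination -h4
  · rw [ofReal_mul_natCast_cpow hx, ← mul_assoc, ← Complex.cpow_add _ _ (natCast_add_one_ne_zero m),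
      mul_comm]
    ring_nf

/-- Ordering the pairs `(i, j)` splits the square of a zeta value into its diagonal part and twice
the sum over `i < j`. -/
theorem two_mul_tsum_shiftTerm_one {t : ℂ} (ht : 0 < t.re) :
    2 * ∑' p, shiftTerm 1 1 t p = riemannZeta (1 + t) ^ 2 - riemannZeta (2 + 2 * t) := by
  have hre : 1 < (1 + t).re := by simpa using ht
  have hre2 : 1 < (2 + 2 * t).re := by
    have : (2 + 2 * t).re = 2 + 2 * t.re := by simp
    rw [this]
    linarith
  set f : ℕ × ℕ → ℂ := fun p => ((p.1 : ℂ) + 1) ^ (-(1 + t)) * ((p.2 : ℂ) + 1) ^ (-(1 + t)) with hf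
  have h0 : HasSum f (riemannZeta (1 + t) * riemannZeta (1 + t)) := hasSum_zeta_mul_zeta hre hre
  have hS := (summable_shiftTerm (ε := 1) (x := 1) zero_le_one one_pos ht).hasSum
  have hlt : HasSum ({p : ℕ × ℕ | p.1 < p.2}.indicator f) (∑' p, shiftTerm 1 1 t p) := by
    have hinj : Function.Injective fun p : ℕ × ℕ => (p.1, p.1 + p.2 + 1) := by
      rintro ⟨a, b⟩ ⟨c, d⟩ h
      simp only [Prod.mk.injEq] at h ⊢
      omega
    rw [← hinj.hasSum_iff]
    · refine hS.congr_fun fun p => ?_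
      have hmem : ((p.1, p.1 + p.2 + 1) : ℕ × ℕ) ∈ {p : ℕ × ℕ | p.1 < p.2} := by
        simp only [Set.mem_ofPred_eq]
        omega
      rw [Function.comp_apply, Set.indicator_of_mem hmem, shiftTerm, hf]
      push_cast
      ring_nf
    · rintro ⟨a, b⟩ hab
      refine Set.indicator_of_notMem (fun h => hab ⟨(a, b - a - 1), ?_⟩) _
      simp only [Set.mem_ofPred_eq] at h
      simp only [Prod.mk.injEq, true_and]
      omega
  have hgt : HasSum ({p : ℕ × ℕ | p.2 < p.1}.indicator f) (∑' p, shiftTerm 1 1 t p) := by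
    rw [← (Equiv.prodComm ℕ ℕ).hasSum_iff]
    refine hlt.congr_fun fun p => ?_
    simp only [Function.comp_apply, Equiv.prodComm_apply, Set.indicator_apply, Set.mem_ofPred_eq,
      Prod.fst_swap, Prod.snd_swap, hf]
    rw [mul_comm]
  have heq : HasSum ({p : ℕ × ℕ | p.1 = p.2}.indicator f) (riemannZeta (2 + 2 * t)) := by
    have hinj : Function.Injective fun n : ℕ => (n, n) := fun a b h => (Prod.mk.inj h).1
    rw [← hinj.hasSum_iff]
    · refine (hasSum_zeta_cpow hre2).congr_fun fun n => ?_
      have hmem : ((n, n) : ℕ × ℕ) ∈ {p : ℕ × ℕ | p.1 = p.2} := rfl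
      rw [Function.comp_apply, Set.indicator_of_mem hmem, hf]
      simp only
      rw [← Complex.cpow_add _ _ (natCast_add_one_ne_zero n)]
      ring_nf
    · rintro ⟨a, b⟩ hab
      refine Set.indicator_of_notMem (fun h => hab ⟨a, ?_⟩) _
      simp only [Set.mem_ofPred_eq] at h
      rw [h]
  have hsum := h0.unique (((hlt.add hgt).add heq).congr_fun fun p => ?_)
  · linear_combination -hsum
  · simp only [Set.indicator_apply, Set.mem_ofPred_eq]
    rcases lt_trichotomy p.1 p.2 with h | h | h
    · simp [h, h.not_gt, h.ne]
    · simp [h]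
    · simp [h, h.not_gt, h.ne']

theorem differentiable_riemannZeta₀_one_add : Differentiable ℂ fun t : ℂ => riemannZeta₀ (1 + t) :=
  differentiable_riemannZeta₀.comp (differentiable_id.const_add _)

/-- The value `F(1)`, in terms of the second Laurent coefficient of `ζ` at `1`. -/
theorem two_mul_F_one : 2 * F 1 = 2 * deriv riemannZeta₀ 1 - (Real.eulerMascheroniConstant : ℂ) ^ 2
    - riemannZeta 2 := by
  have h0 : (0 : ℂ) ∈ {t : ℂ | -(1 / 8) < t.re} := by
    change -(1 / 8) < (0 : ℂ).re
    norm_num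
  have hK : AnalyticAt ℂ (kernelSum 1 1) 0 :=
    (differentiableOn_kernelSum zero_le_one le_rfl one_pos).analyticAt
      ((isOpen_halfPlane _).mem_nhds h0)
  have hZ := differentiable_riemannZeta₀_one_add
  have hZ2 : Differentiable ℂ fun t : ℂ => riemannZeta₀ (1 + 2 * t) :=
    differentiable_riemannZeta₀.comp ((differentiable_id.const_mul 2).const_add _)
  have hζ : AnalyticAt ℂ (fun t : ℂ => riemannZeta (2 + 2 * t)) 0 := by
    have h2 : AnalyticAt ℂ riemannZeta ((fun t : ℂ => 2 + 2 * t) 0) :=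
      differentiableOn_riemannZeta.analyticAt (isOpen_compl_singleton.mem_nhds (by simp))
    have hlin : AnalyticAt ℂ (fun t : ℂ => 2 + 2 * t) 0 := by fun_prop
    exact AnalyticAt.comp (f := fun t : ℂ => 2 + 2 * t) h2 hlin
  set g : ℂ → ℂ := fun t => 2 * (riemannZeta₀ (1 + t) - riemannZeta₀ (1 + 2 * t)) +
    t * (riemannZeta₀ (1 + t) ^ 2 - riemannZeta (2 + 2 * t)) with hg
  have hga : AnalyticAt ℂ g 0 :=
    (analyticAt_const.mul ((hZ.analyticAt 0).sub (hZ2.analyticAt 0))).add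
      (analyticAt_id.mul (((hZ.analyticAt 0).pow 2).sub hζ))
  -- the poles of `t * ζ(1 + t) ^ 2` and `2 * ζ(1 + 2 * t)` cancel
  have hpos : ∀ t : ℂ, 0 < t.re → 2 * kernelSum 1 1 t = g t := by
    intro t ht
    have ht0 : t ≠ 0 := by
      rintro rfl
      simp at ht
    have e1 := kernelSum_eq (ε := 1) zero_le_one le_rfl one_pos ht
    have e2 := two_mul_tsum_shiftTerm_one ht
    simp only [Complex.ofReal_one, Complex.one_cpow, one_mul] at e1
    rw [show (1 : ℂ) + (1 + 1) * t = 1 + 2 * t by ring,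
      riemannZeta_eq_inv_sub_add (s := 1 + 2 * t) (by simpa using ht0)] at e1
    rw [riemannZeta_eq_inv_sub_add (s := 1 + t) (by simpa using ht0)] at e2
    simp only [add_sub_cancel_left] at e1 e2
    have e3 : t * (2 * ∑' p, shiftTerm 1 1 t p) = t * ((t⁻¹ + riemannZeta₀ (1 + t)) ^ 2 -
        riemannZeta (2 + 2 * t)) := by rw [e2]
    have e4 : t * t⁻¹ = 1 := mul_inv_cancel₀ ht0
    rw [e1, hg]
    simp only [mul_inv]
    linear_combination e3 + (t⁻¹ + 2 * riemannZeta₀ (1 + t)) * e4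
  -- analyticity carries the identity from the positive axis to a neighbourhood of `0`
  have hev : (fun t => 2 * kernelSum 1 1 t) =ᶠ[𝓝 0] g := by
    have hK2 : AnalyticAt ℂ (fun t => 2 * kernelSum 1 1 t) 0 := analyticAt_const.mul hK
    refine (hK2.frequently_eq_iff_eventually_eq hga).1 ?_
    have hmap : Tendsto (fun s : ℝ => (s : ℂ)) (𝓝[>] 0) (𝓝[≠] 0) := by
      refine tendsto_nhdsWithin_of_tendsto_nhds_of_eventually_within _ ?_ ?_
      · exact (Complex.continuous_ofReal.tendsto' 0 0 (by simp)).mono_left nhdsWithin_le_nhds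
      · filter_upwards [self_mem_nhdsWithin] with s hs
        simpa using (ne_of_gt hs : s ≠ 0)
    refine hmap.frequently (Eventually.frequently ?_)
    filter_upwards [self_mem_nhdsWithin] with s hs
    exact hpos s (by simpa using hs)
  have hd := hev.deriv_eq
  have hZ0 : HasDerivAt riemannZeta₀ (deriv riemannZeta₀ 1) (1 + 0) := by
    rw [add_zero]
    exact (differentiable_riemannZeta₀ 1).hasDerivAt
  have hZ0' : HasDerivAt riemannZeta₀ (deriv riemannZeta₀ 1) (1 + 2 * 0) := by
    simpa using hZ0
  have d1 : HasDerivAt (fun t : ℂ => riemannZeta₀ (1 + t)) (deriv riemannZeta₀ 1 * 1) 0 :=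
    hZ0.comp (0 : ℂ) ((hasDerivAt_id (0 : ℂ)).const_add 1)
  have d2 : HasDerivAt (fun t : ℂ => riemannZeta₀ (1 + 2 * t)) (deriv riemannZeta₀ 1 * (2 * 1)) 0 := by
    have hlin : HasDerivAt (fun t : ℂ => 1 + 2 * t) (2 * 1) 0 :=
      ((hasDerivAt_id (0 : ℂ)).const_mul 2).const_add 1
    exact HasDerivAt.comp (0 : ℂ) hZ0' hlin
  have d3 : HasDerivAt g _ 0 := ((d1.sub d2).const_mul 2).add
    ((hasDerivAt_id (0 : ℂ)).mul ((d1.pow 2).sub hζ.differentiableAt.hasDerivAt))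
  rw [d3.deriv, deriv_const_mul _ hK.differentiableAt,
    deriv_kernelSum_zero zero_le_one le_rfl one_pos] at hd
  simp only [id, add_zero, mul_zero, zero_mul, Complex.ofReal_one, div_one, mul_one, one_mul,
    riemannZeta₀_one] at hd
  linear_combination -hd

/-! ### The double series for `r = 1` -/

/-- The partial fraction `1 / (n m) = 1 / (m (n + m x)) + x / (n (n + m x))` splits the double
series. -/
theorem thetaSeries_one_one {x : ℝ} (hx : 0 < x) {t : ℂ} (ht : 0 < t.re) :
    thetaSeries 1 1 t x = ∑' p, shiftTerm 0 x t p +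
      (x : ℂ) ^ (-t) * ∑' p, shiftTerm 0 (1 / x) t p := by
  have hx' : (x : ℂ) ≠ 0 := by exact_mod_cast hx.ne'
  have h1 := (Equiv.prodComm ℕ ℕ).hasSum_iff.2
    (summable_shiftTerm (ε := 0) le_rfl hx ht).hasSum
  have h2 := (summable_shiftTerm (ε := 0) le_rfl (one_div_pos.2 hx) ht).hasSum.mul_left
    ((x : ℂ) ^ (-t))
  have h3 : HasSum (fun p : ℕ × ℕ => 1 / (((p.1 : ℂ) + 1) ^ (1 : ℂ) * ((p.2 : ℂ) + 1) ^ (1 : ℂ) *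
      (((p.1 : ℂ) + 1) + ((p.2 : ℂ) + 1) * (x : ℂ)) ^ t))
      (∑' p, shiftTerm 0 x t p + (x : ℂ) ^ (-t) * ∑' p, shiftTerm 0 (1 / x) t p) := by
    refine (h1.add h2).congr_fun fun p => ?_
    have hn0 := natCast_add_one_ne_zero p.1
    have hm0 := natCast_add_one_ne_zero p.2
    have hne := natCast_add_mul_ne_zero p.1 p.2 hx
    set u : ℂ := ((p.1 : ℂ) + 1) + ((p.2 : ℂ) + 1) * (x : ℂ) with hu
    have e1 : ((p.2 : ℂ) + 1) * x + p.1 + 1 = u := by rw [hu]; ring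
    have e2 : (((p.1 : ℂ) + 1) * ((1 / x : ℝ) : ℂ) + p.2 + 1) ^ (-1 - t) =
        u ^ (-1 - t) * (x : ℂ) ^ (1 + t) := by
      have h := Complex.mul_cpow_ofReal_nonneg
        (a := ((p.1 : ℝ) + 1) * (1 / x) + p.2 + 1) (b := x) (by positivity) hx.le (-1 - t)
      have e3 : (((((p.1 : ℝ) + 1) * (1 / x) + p.2 + 1 : ℝ) : ℂ) * x) = u := by
        rw [hu]
        push_cast
        field_simp
        ring
      rw [e3] at h
      rw [h, mul_assoc, ← Complex.cpow_add _ _ hx']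
      simp
    have e4 : u ^ (-1 - t) = u⁻¹ * (u ^ t)⁻¹ := by
      rw [sub_eq_add_neg, Complex.cpow_add _ _ hne, Complex.cpow_neg_one, Complex.cpow_neg]
    have e5 : (x : ℂ) ^ (1 + t) = x * (x : ℂ) ^ t := by
      rw [Complex.cpow_add _ _ hx', Complex.cpow_one]
    have hut : u ^ t ≠ 0 := by simp [Complex.cpow_eq_zero_iff, hne]
    have hxt : (x : ℂ) ^ t ≠ 0 := by simp [Complex.cpow_eq_zero_iff, hx']
    simp only [Function.comp_apply, Equiv.prodComm_apply, shiftTerm, Prod.fst_swap, Prod.snd_swap,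
      e1, e2, e4, e5, Complex.ofReal_zero, zero_mul, add_zero, Complex.cpow_one, Complex.cpow_neg]
    have hu' : (p.1 : ℂ) + 1 + ((p.2 : ℂ) + 1) * x = u := rfl
    field_simp
    linear_combination hu
  have h4 := h3.summable.tsum_prod
  rw [h3.tsum_eq] at h4
  rw [thetaSeries, ← h4]

/-- The part of `Θ(1, 1, t, x)` that is regular at `t = 0`. -/
noncomputable def regularPartOne (x : ℝ) (t : ℂ) : ℂ :=
  dslope (kernelSum 0 x) 0 t + (x : ℂ) ^ (-t) * dslope (kernelSum 0 (1 / x)) 0 t +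
    (dslope (dslope (fun t : ℂ => 1 + (x : ℂ) ^ (-t)) 0) 0 t +
      dslope (fun t : ℂ => (1 + (x : ℂ) ^ (-t)) * riemannZeta₀ (1 + t)) 0 t)

theorem analyticAt_dslope_kernelSum {x : ℝ} (hx : 0 < x) {t : ℂ} (ht : -(1 / 8) < t.re) :
    AnalyticAt ℂ (dslope (kernelSum 0 x) 0) t := by
  have h0 : (0 : ℂ) ∈ {t : ℂ | -(1 / 8) < t.re} := by
    change -(1 / 8) < (0 : ℂ).re
    norm_num
  exact ((Complex.differentiableOn_dslope ((isOpen_halfPlane _).mem_nhds h0)).2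
    (differentiableOn_kernelSum le_rfl zero_le_one hx)).analyticAt
      ((isOpen_halfPlane _).mem_nhds ht)

theorem differentiable_one_add_cpow_neg_mul_zeta {x : ℝ} (hx : 0 < x) :
    Differentiable ℂ fun t : ℂ => (1 + (x : ℂ) ^ (-t)) * riemannZeta₀ (1 + t) :=
  (differentiable_one_add_cpow_neg hx).mul differentiable_riemannZeta₀_one_add

theorem analyticAt_regularPartOne {x : ℝ} (hx : 0 < x) {t : ℂ} (ht : -(1 / 8) < t.re) :
    AnalyticAt ℂ (regularPartOne x) t := by
  have hx' : (x : ℂ) ≠ 0 := by exact_mod_cast hx.ne'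
  exact ((analyticAt_dslope_kernelSum hx ht).add
    (((differentiable_const_cpow_neg hx').analyticAt t).mul
      (analyticAt_dslope_kernelSum (one_div_pos.2 hx) ht))).add
    (((differentiable_dslope (differentiable_dslope (differentiable_one_add_cpow_neg hx) 0)
      0).analyticAt t).add
      ((differentiable_dslope (differentiable_one_add_cpow_neg_mul_zeta hx) 0).analyticAt t))

theorem Theta_one_one_eq {x : ℝ} (hx : 0 < x) {t : ℂ} (ht : -(1 / 8) < t.re) (ht₀ : t ≠ 0) :
    Theta 1 1 t x = regularPartOne x t +
      (2 / t ^ 2 + (2 * (Real.eulerMascheroniConstant : ℂ) - Real.log x) / t) := by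
  have hx' : (x : ℂ) ≠ 0 := by exact_mod_cast hx.ne'
  refine Theta_eq_of_meromorphicOn (t₀ := 0) (σ := -(1 / 8))
    (G := fun t => regularPartOne x t +
      (2 / t ^ 2 + (2 * (Real.eulerMascheroniConstant : ℂ) - Real.log x) / t)) ?_ ?_ ?_ ht ht₀
  · intro z hz
    exact (analyticAt_regularPartOne hx hz).meromorphicAt.add
      ((analyticAt_const.meromorphicAt.div (analyticAt_id.pow 2).meromorphicAt).add
        (analyticAt_const.meromorphicAt.div analyticAt_id.meromorphicAt))
  · intro z hz hz₀
    exact (analyticAt_regularPartOne hx hz).add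
      ((analyticAt_const.div (analyticAt_id.pow 2) (pow_ne_zero 2 hz₀)).add
        (analyticAt_const.div analyticAt_id hz₀))
  · intro z hz
    have hz1 : 0 < z.re := by simpa using hz.1
    have hz₀ : z ≠ 0 := by
      rintro rfl
      simp at hz1
    refine ⟨hz₀, ?_⟩
    have k1 := kernelSum_eq (ε := 0) le_rfl zero_le_one hx hz1
    have k2 := kernelSum_eq (ε := 0) le_rfl zero_le_one (one_div_pos.2 hx) hz1
    have hinv : ((1 / x : ℝ) : ℂ) ^ (-z) = ((x : ℂ) ^ (-z))⁻¹ := by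
      rw [one_div, Complex.ofReal_inv, Complex.inv_cpow, Complex.cpow_neg]
      rw [Complex.arg_ofReal_of_nonneg hx.le]
      exact Real.pi_ne_zero.symm
    rw [hinv] at k2
    simp only [Complex.ofReal_zero, add_zero, one_mul] at k1 k2
    rw [riemannZeta_eq_inv_sub_add (s := 1 + z) (by simpa using hz₀), add_sub_cancel_left] at k1 k2
    have d1 := sub_smul_dslope (kernelSum 0 x) 0 z
    have d2 := sub_smul_dslope (kernelSum 0 (1 / x)) 0 z
    have d3 := sub_smul_dslope (fun t : ℂ => 1 + (x : ℂ) ^ (-t)) 0 z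
    have d4 := sub_smul_dslope (dslope (fun t : ℂ => 1 + (x : ℂ) ^ (-t)) 0) 0 z
    have d5 := sub_smul_dslope (fun t : ℂ => (1 + (x : ℂ) ^ (-t)) * riemannZeta₀ (1 + t)) 0 z
    rw [dslope_same, ((hasDerivAt_ofReal_cpow_neg hx 0).const_add 1).deriv] at d4
    simp only [sub_zero, smul_eq_mul, kernelSum_zero, neg_zero, Complex.cpow_zero, add_zero,
      one_mul, riemannZeta₀_one] at d1 d2 d3 d4 d5
    rw [thetaSeries_one_one hx hz1, regularPartOne]
    have hxz : (x : ℂ) ^ (-z) ≠ 0 := by simp [Complex.cpow_eq_zero_iff, hx']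
    generalize (x : ℂ) ^ (-z) = w at *
    generalize dslope (kernelSum 0 x) 0 z = a1 at *
    generalize dslope (kernelSum 0 (1 / x)) 0 z = a2 at *
    generalize dslope (dslope (fun t : ℂ => 1 + (x : ℂ) ^ (-t)) 0) 0 z = a4 at *
    generalize dslope (fun t : ℂ => 1 + (x : ℂ) ^ (-t)) 0 z = a3 at *
    generalize dslope (fun t : ℂ => (1 + (x : ℂ) ^ (-t)) * riemannZeta₀ (1 + t)) 0 z = a5 at *
    have hz := mul_inv_cancel₀ hz₀
    have hw := mul_inv_cancel₀ hxz
    have hs1 : z ^ 2 * ∑' p, shiftTerm 0 x z p =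
        z ^ 2 * a1 + w * (1 + z * riemannZeta₀ (1 + z)) := by
      linear_combination -z * k1 - z * d1 + w * hz
    have hs2 : z ^ 2 * ∑' p, shiftTerm 0 (1 / x) z p =
        z ^ 2 * a2 + w⁻¹ * (1 + z * riemannZeta₀ (1 + z)) := by
      linear_combination -z * k2 - z * d2 + w⁻¹ * hz
    have hpole : z ^ 2 * (2 / z ^ 2 + (2 * (Real.eulerMascheroniConstant : ℂ) - Real.log x) / z) =
        2 + (2 * (Real.eulerMascheroniConstant : ℂ) - Real.log x) * z := by
      field_simp
    refine mul_left_cancel₀ (pow_ne_zero 2 hz₀) ?_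
    rw [mul_add (z ^ 2) (_ + _) (_ / _ + _), hpole]
    linear_combination -hs1 - w * hs2 - (1 + z * riemannZeta₀ (1 + z)) * hw + z * d4 + d3 + z * d5

/-- The coefficient of `(t - a) ^ 2` in the Taylor expansion is half the second derivative. -/
theorem two_mul_deriv_dslope {f : ℂ → ℂ} (hf : Differentiable ℂ f) (a : ℂ) :
    2 * deriv (dslope f a) a = deriv (deriv f) a := by
  have hg := differentiable_dslope hf a
  have h1 : deriv f = fun t => dslope f a t + (t - a) * deriv (dslope f a) t := by
    ext t
    have h2 : f = fun t => f a + (t - a) * dslope f a t := by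
      ext s
      have := sub_smul_dslope f a s
      rw [smul_eq_mul] at this
      rw [this]
      ring
    have h3 := ((((hasDerivAt_id t).sub_const a).mul (hg t).hasDerivAt).const_add (f a)).deriv
    simp only [id, one_mul] at h3
    conv_lhs => rw [h2]
    exact h3
  have hg' : Differentiable ℂ (deriv (dslope f a)) := fun z =>
    (hg.analyticAt z).deriv.differentiableAt
  have h4 := ((hg a).hasDerivAt.add (((hasDerivAt_id a).sub_const a).mul (hg' a).hasDerivAt)).deriv
  simp only [id, sub_self, zero_mul, add_zero, one_mul] at h4
  conv_rhs => rw [h1]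
  refine Eq.trans ?_ h4.symm
  ring

/-- The constant term of `Θ(1, 1, t, x)` at `t = 0`. -/
theorem regularPartOne_zero {x : ℝ} (hx : 0 < x) : regularPartOne x 0 =
    -F x - F (1 / (x : ℂ)) - riemannZeta 2 * (x + 1 / x) + (1 / 2) * (Real.log x : ℂ) ^ 2
      + 2 * deriv riemannZeta₀ 1 - Real.eulerMascheroniConstant * Real.log x := by
  have hd : deriv (fun t : ℂ => 1 + (x : ℂ) ^ (-t)) =
      fun t => -((x : ℂ) ^ (-t) * (Real.log x : ℂ)) := by
    ext t
    exact ((hasDerivAt_ofReal_cpow_neg hx t).const_add 1).deriv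
  have h2 := two_mul_deriv_dslope (differentiable_one_add_cpow_neg hx) 0
  rw [hd, ((hasDerivAt_ofReal_cpow_neg hx 0).mul_const _).fun_neg.deriv] at h2
  have hZ0 : HasDerivAt riemannZeta₀ (deriv riemannZeta₀ 1) (1 + 0) := by
    rw [add_zero]
    exact (differentiable_riemannZeta₀ 1).hasDerivAt
  have d1 : HasDerivAt (fun t : ℂ => riemannZeta₀ (1 + t)) (deriv riemannZeta₀ 1 * 1) 0 :=
    hZ0.comp (0 : ℂ) ((hasDerivAt_id (0 : ℂ)).const_add 1)
  have h3 := (((hasDerivAt_ofReal_cpow_neg hx 0).const_add 1).mul d1).deriv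
  simp only [neg_zero, Complex.cpow_zero, add_zero, riemannZeta₀_one, one_mul, mul_one] at h2 h3
  rw [regularPartOne]
  simp only [dslope_same]
  rw [deriv_kernelSum_zero le_rfl zero_le_one hx,
    deriv_kernelSum_zero le_rfl zero_le_one (one_div_pos.2 hx)]
  have h3' : deriv (fun t : ℂ => (1 + (x : ℂ) ^ (-t)) * riemannZeta₀ (1 + t)) 0 = _ := h3
  rw [h3']
  simp only [neg_zero, Complex.cpow_zero, Complex.ofReal_div, Complex.ofReal_one]
  rw [div_div_eq_mul_div, div_one]
  linear_combination (1 / 2) * h2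

theorem twoTermF_iff_kroneckerLimitOne {x : ℝ} (hx : 0 < x) : TwoTermF x ↔ KroneckerLimitOne x := by
  have hx' : (x : ℂ) ≠ 0 := by exact_mod_cast hx.ne'
  have h0 : (0 : ℂ) ∈ {t : ℂ | -(1 / 8) < t.re} := by
    change -(1 / 8) < (0 : ℂ).re
    norm_num
  set κ : ℂ := (Real.eulerMascheroniConstant : ℂ) ^ 2
        - (Real.eulerMascheroniConstant : ℂ) * Real.log x - (Real.pi : ℂ) ^ 2 / 6 with hκ
  have hO : (fun t => regularPartOne x t - regularPartOne x 0) =O[𝓝[≠] (0 : ℂ)] fun t => t := by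
    have := (analyticAt_regularPartOne hx h0).differentiableAt.isBigO_sub
    simpa using this.mono nhdsWithin_le_nhds
  have hK : KroneckerLimitOne x ↔
      (fun t => regularPartOne x t - κ) =O[𝓝[≠] (0 : ℂ)] fun t => t := by
    refine isBigO_congr ?_ EventuallyEq.rfl
    filter_upwards [mem_nhdsWithin_of_mem_nhds ((isOpen_halfPlane _).mem_nhds h0),
      self_mem_nhdsWithin] with t ht ht₀
    rw [Theta_one_one_eq hx ht ht₀, hκ]
    ring
  have hT : TwoTermF x ↔ regularPartOne x 0 = κ := by
    have hF := two_mul_F_one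
    have hr := regularPartOne_zero hx
    rw [TwoTermF, hr, hκ]
    rw [riemannZeta_two] at hF ⊢
    have e : (Real.pi : ℂ) ^ 2 / (6 * (x : ℂ)) * ((x : ℂ) - 1) ^ 2 =
        (Real.pi : ℂ) ^ 2 / 6 * (x + 1 / x - 2) := by
      field_simp
      ring
    rw [e]
    constructor <;> intro h <;> linear_combination -h - hF
  rw [hT, hK]
  constructor
  · intro h
    rwa [h] at hO
  · intro h
    have h1 : (fun _ : ℂ => regularPartOne x 0 - κ) =O[𝓝[≠] (0 : ℂ)] fun t => t := by
      refine (h.sub hO).congr_left fun t => ?_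
      ring
    have h2 : Tendsto (fun _ : ℂ => regularPartOne x 0 - κ) (𝓝[≠] (0 : ℂ)) (𝓝 0) :=
      h1.trans_tendsto (tendsto_id.mono_left nhdsWithin_le_nhds)
    exact sub_eq_zero.1 (tendsto_nhds_unique tendsto_const_nhds h2)

end HerglotzZagier

theorem theorem1p2 :
    (∀ x : ℝ, 0 < x →
      (HerglotzZagier.TwoTermF x ↔ HerglotzZagier.KroneckerLimitOne x)) ∧
    (∀ r : ℕ, 1 < r → ∀ x : ℝ, 0 < x →
      (HerglotzZagier.TwoTermHigherF r x ↔ HerglotzZagier.KroneckerLimitHigher r x)) :=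
  ⟨fun _ hx => HerglotzZagier.twoTermF_iff_kroneckerLimitOne hx, fun _ hr _ hx =>
    iff_of_true (HerglotzZagier.twoTermHigherF hr hx) (HerglotzZagier.kroneckerLimitHigher hr hx)⟩
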